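/- Let $0<q<1$ and $\alpha\in\mathbb{R}\setminus\{0\}$. Let $B=B(\alpha,q)$ be the self-adjoint operator on the complex Hilbert space $\ell^2(\mathbb{Z})$ with domain $\operatorname{Dom}B=\{\psi\in\ell^2(\mathbb{Z}) : (q^{-n}\psi_n)_{n\in\mathbb{Z}}\in\ell^2(\mathbb{Z})\}$ acting by $$(B\psi)_n=\psi_{n-1}+\alpha q^{-n}\psi_n+\psi_{n+1},\qquad n\in\mathbb{Z}.$$ Write $(a;q)_k=\prod_{i=0}^{k-1}(1-aq^i)$ and $(a;q)_\infty=\prod_{i=0}^{\infty}(1-aq^i)$, and let $${}_1\tilde\phi_1(a;b;q,z)=\sum_{k=0}^{\infty}\frac{(a;q)_k\,(bq^k;q)_\infty}{(q;q)_k}(-1)^kq^{k(k-1)/2}z^k$$ be the regularized confluent basic hypergeometric series, which equals $(b;q)_\infty\,{}_1\phi_1(a;b;q,z)$ whenever $b\notin\{q^{-i} : i=0,1,2,\dots\}$. Then $$\operatorname{spec}(B)\setminus[-2,2]=\operatorname{spec}_p(B)=\left\{\alpha^{-1}q^m+\alpha q^{-m} : m\in\mathbb{Z},\ m>\lfloor\log_q|\alpha|\rfloor\right\},$$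 where $\operatorname{spec}_p(B)$ is the set of eigenvalues of $B$, and every point of this set is a simple eigenvalue of $B$, i.e. $\dim\operatorname{Ker}(B-x)=1$. Moreover, for each integer $m>\lfloor\log_q|\alpha|\rfloor$, the sequence $\mathbf{v}_m=(v_{m,j})_{j\in\mathbb{Z}}$ with $$v_{m,j}=(-1)^j\alpha^{-j}q^{j(j+1)/2}\,{}_1\tilde\phi_1\!\left(0;q^{-m+j+1};q,\alpha^{-2}q^{m+j+1}\right)$$ is a (nonzero, square-summable) eigenvector of $B$ corresponding to the eigenvalue $\alpha^{-1}q^m+\alpha q^{-m}$. -/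

import Mathlib

noncomputable section

/-- The complex Hilbert space `ℓ²(ℤ)`. -/
abbrev EllTwo : Type := lp (fun _ : ℤ => ℂ) 2

section UnboundedOperators

variable {H : Type*} [NormedAddCommGroup H] [InnerProductSpace ℂ H]

/-- `x` belongs to the resolvent set of the (unbounded) operator `T` if `T - x : Dom T → H` has a
bounded everywhere defined two-sided inverse `R`. -/
def InResolventSet (T : H →ₗ.[ℂ] H) (x : ℂ) : Prop :=
  ∃ R : H →L[ℂ] H,
    (∀ φ : H, ∃ h : R φ ∈ T.domain, T ⟨R φ, h⟩ - x • R φ = φ) ∧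
    (∀ ψ : T.domain, R (T ψ - x • (ψ : H)) = ψ)

/-- The spectrum of an unbounded operator: the complement of its resolvent set. -/
def opSpectrum (T : H →ₗ.[ℂ] H) : Set ℂ :=
  {x | ¬ InResolventSet T x}

/-- The eigenspace `Ker (T - x)`, as a subspace of `H`. -/
def opEigenspace (T : H →ₗ.[ℂ] H) (x : ℂ) : Submodule ℂ H :=
  (LinearMap.ker (T.toFun - x • T.domain.subtype)).map T.domain.subtype

/-- The point spectrum: the set of eigenvalues. -/
def pointSpectrum (T : H →ₗ.[ℂ] H) : Set ℂ :=
  {x | opEigenspace T x ≠ ⊥}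

/-- An eigenvalue is simple if its eigenspace is one-dimensional. -/
def IsSimpleEigenvalue (T : H →ₗ.[ℂ] H) (x : ℂ) : Prop :=
  Module.finrank ℂ (opEigenspace T x) = 1

theorem mem_opEigenspace_iff (T : H →ₗ.[ℂ] H) (x : ℂ) (ψ : H) :
    ψ ∈ opEigenspace T x ↔ ∃ h : ψ ∈ T.domain, T ⟨ψ, h⟩ = x • ψ := by
  simp only [opEigenspace, Submodule.mem_map, LinearMap.mem_ker, LinearMap.sub_apply,
    LinearMap.smul_apply, sub_eq_zero]
  constructor
  · rintro ⟨y, hy, rfl⟩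
    exact ⟨y.2, hy⟩
  · rintro ⟨h, hx⟩
    exact ⟨⟨ψ, h⟩, hx, rfl⟩

end UnboundedOperators

section OperatorB

theorem memlp_shift (ψ : EllTwo) (k : ℤ) : Memℓp (fun n : ℤ => ψ (n + k)) 2 := by
  have h := lp.memℓp ψ
  rw [memℓp_gen_iff (by norm_num)] at h ⊢
  exact (Equiv.addRight k).summable_iff.mpr h

/-- The natural domain `{ψ ∈ ℓ²(ℤ) | Vψ ∈ ℓ²(ℤ)}` of the multiplication operator
`(Vψ)ₙ = q⁻ⁿ ψₙ`. -/
def domV (q : ℝ) : Submodule ℂ EllTwo where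
  carrier := {ψ | Memℓp (fun n : ℤ => (q : ℂ) ^ (-n) * ψ n) 2}
  zero_mem' := by
    have h : (fun n : ℤ => (q : ℂ) ^ (-n) * (0 : EllTwo) n) = 0 := by
      funext n; simp
    show Memℓp _ 2
    rw [h]
    exact zero_memℓp
  add_mem' := by
    intro φ ψ hφ hψ
    have h : (fun n : ℤ => (q : ℂ) ^ (-n) * (φ + ψ : EllTwo) n)
        = (fun n : ℤ => (q : ℂ) ^ (-n) * φ n) + (fun n : ℤ => (q : ℂ) ^ (-n) * ψ n) := by
      funext n; simp [mul_add]
    show Memℓp _ 2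
    rw [h]
    exact Memℓp.add hφ hψ
  smul_mem' := by
    intro c ψ hψ
    have h : (fun n : ℤ => (q : ℂ) ^ (-n) * (c • ψ : EllTwo) n)
        = c • (fun n : ℤ => (q : ℂ) ^ (-n) * ψ n) := by
      funext n; simp [mul_left_comm]
    show Memℓp _ 2
    rw [h]
    exact Memℓp.const_smul hψ c

theorem memlp_opB (α q : ℝ) (ψ : domV q) :
    Memℓp (fun n : ℤ => (ψ : EllTwo) (n - 1) + (α : ℂ) * (q : ℂ) ^ (-n) * (ψ : EllTwo) n
      + (ψ : EllTwo) (n + 1)) 2 := by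
  have h1 := memlp_shift (ψ : EllTwo) (-1)
  have h2 := memlp_shift (ψ : EllTwo) 1
  have h3 : Memℓp (fun n : ℤ => (q : ℂ) ^ (-n) * (ψ : EllTwo) n) 2 := ψ.2
  have h := (h1.add (h3.const_smul (α : ℂ))).add h2
  convert h using 1
  funext n
  simp [sub_eq_add_neg, mul_assoc]

/-- The discrete Schrödinger operator `B = U + U* + αV` on `ℓ²(ℤ)`, with domain `Dom V`; thus
`(Bψ)ₙ = ψₙ₋₁ + α q⁻ⁿ ψₙ + ψₙ₊₁`. -/
def opB (α q : ℝ) : EllTwo →ₗ.[ℂ] EllTwo where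
  domain := domV q
  toFun :=
    { toFun := fun ψ => ⟨fun n : ℤ => (ψ : EllTwo) (n - 1)
          + (α : ℂ) * (q : ℂ) ^ (-n) * (ψ : EllTwo) n + (ψ : EllTwo) (n + 1), memlp_opB α q ψ⟩
      map_add' := by
        intro φ ψ
        ext n
        show (φ : EllTwo) (n - 1) + (ψ : EllTwo) (n - 1)
            + (α : ℂ) * (q : ℂ) ^ (-n) * ((φ : EllTwo) n + (ψ : EllTwo) n)
            + ((φ : EllTwo) (n + 1) + (ψ : EllTwo) (n + 1))
          = ((φ : EllTwo) (n - 1) + (α : ℂ) * (q : ℂ) ^ (-n) * (φ : EllTwo) n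
              + (φ : EllTwo) (n + 1))
            + ((ψ : EllTwo) (n - 1) + (α : ℂ) * (q : ℂ) ^ (-n) * (ψ : EllTwo) n
              + (ψ : EllTwo) (n + 1))
        ring
      map_smul' := by
        intro c ψ
        ext n
        simp
        ring }

end OperatorB

section BasicHypergeometric

/-- The finite `q`-shifted factorial `(a; q)ₖ = ∏_{i<k} (1 - a qⁱ)`. -/
def qPoch (a q : ℂ) (k : ℕ) : ℂ :=
  ∏ i ∈ Finset.range k, (1 - a * q ^ i)

/-- The infinite `q`-shifted factorial `(a; q)_∞ = ∏_{i≥0} (1 - a qⁱ)`. -/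
def qPochInf (a q : ℂ) : ℂ :=
  ∏' i : ℕ, (1 - a * q ^ i)

/-- The basic hypergeometric series `₁φ₁(a; b; q, z)`, for `b ∉ {1, q⁻¹, q⁻², …}`. -/
def phiOneOne (a b q z : ℂ) : ℂ :=
  ∑' k : ℕ, qPoch a q k / (qPoch q q k * qPoch b q k) * (-1) ^ k * q ^ (k.choose 2) * z ^ k

/-- The regularized series `₁φ̃₁(a; b; q, z)`, that is `(b; q)_∞ ₁φ₁(a; b; q, z)`
(see `regPhiOneOne_eq`), continued analytically to all `b ∈ ℂ` by means of
`(b; q)_∞ / (b; q)ₖ = (b qᵏ; q)_∞`. -/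
def regPhiOneOne (a b q z : ℂ) : ℂ :=
  ∑' k : ℕ, qPoch a q k * qPochInf (b * q ^ k) q / qPoch q q k
    * (-1) ^ k * q ^ (k.choose 2) * z ^ k

theorem multipliable_qPoch (a q : ℂ) (hq : ‖q‖ < 1) :
    Multipliable (fun i : ℕ => 1 - a * q ^ i) := by
  have h : Summable (fun i : ℕ => -(a * q ^ i)) :=
    ((summable_geometric_of_norm_lt_one hq).mul_left a).neg
  simpa [sub_eq_add_neg] using Complex.multipliable_one_add_of_summable h

theorem qPochInf_eq (b q : ℂ) (hq : ‖q‖ < 1) (k : ℕ) :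
    qPochInf b q = qPoch b q k * qPochInf (b * q ^ k) q := by
  induction k with
  | zero => simp [qPoch]
  | succ k ih =>
    rw [ih, qPoch, qPoch, Finset.prod_range_succ, mul_assoc]
    congr 1
    have h := (multipliable_qPoch (b * q ^ (k + 1)) q hq)
    have h' : (fun i : ℕ => 1 - b * q ^ (k + 1) * q ^ i)
        = fun i : ℕ => 1 - b * q ^ k * q ^ (i + 1) := by
      funext i; ring
    rw [qPochInf, qPochInf, h']
    rw [h'] at h
    have h2 : ∏' i : ℕ, (1 - b * q ^ k * q ^ i)
        = (1 - b * q ^ k * q ^ 0) * ∏' i : ℕ, (1 - b * q ^ k * q ^ (i + 1)) :=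
      tprod_eq_zero_mul' (f := fun i : ℕ => 1 - b * q ^ k * q ^ i) h
    rw [h2, pow_zero, mul_one]

/-- Where `₁φ₁` is defined, the regularized series is `(b; q)_∞ ₁φ₁(a; b; q, z)`. -/
theorem regPhiOneOne_eq (a b q z : ℂ) (hq : ‖q‖ < 1) (hb : ∀ i : ℕ, b * q ^ i ≠ 1) :
    regPhiOneOne a b q z = qPochInf b q * phiOneOne a b q z := by
  rw [regPhiOneOne, phiOneOne, ← tsum_mul_left]
  congr 1
  funext k
  have h0 : qPoch b q k ≠ 0 :=
    Finset.prod_ne_zero_iff.mpr fun i _ => sub_ne_zero.mpr (hb i).symm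
  rw [qPochInf_eq b q hq k, ← div_div]
  field_simp

end BasicHypergeometric

/-- The eigenvalue `α⁻¹ qᵐ + α q⁻ᵐ`. -/
def eigvalB (α q : ℝ) (m : ℤ) : ℂ :=
  (α : ℂ)⁻¹ * (q : ℂ) ^ m + (α : ℂ) * (q : ℂ) ^ (-m)

/-- The components
`v_{m,j} = (-1)ʲ α⁻ʲ q^{j(j+1)/2} ₁φ̃₁(0; q^{-m+j+1}; q, α⁻² q^{m+j+1})`. The integer division
`j (j + 1) / 2` is exact. -/
def eigvecB (α q : ℝ) (m j : ℤ) : ℂ :=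
  (-1) ^ j * (α : ℂ) ^ (-j) * (q : ℂ) ^ (j * (j + 1) / 2)
    * regPhiOneOne 0 ((q : ℂ) ^ (-m + j + 1)) q ((α : ℂ) ^ (-2 : ℤ) * (q : ℂ) ^ (m + j + 1))

end

/-!
Write `x = w + w⁻¹` with `0 < ‖w‖ ≤ 1`. If `ψ` is a decaying solution of the eigenvalue equation,
then dividing its generating function `∑ ψₙ zⁿ` by `(qwz; q)_∞` produces a sequence `h` which
satisfies the first order recurrence `hₙ₊₁ = (w⁻¹ - α q⁻ⁿ) hₙ`. As `h` is bounded, one of the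
factors must vanish, that is `α w = q ^ m` for some `m`; if moreover `‖w‖ = 1`, then all factors
to the left of that zero have norm at most one, which is incompatible with decay at `-∞`.
Conversely, if `w = α⁻¹ q ^ m` and `‖w‖ < 1`, then the coefficients of `(qw/z; q)_∞ / (wz; q)_∞`
solve the reflected equation, and these are the components of `v_m` up to a constant. Eigenvalues
are simple because the Casoratian of two decaying solutions is constant and tends to zero.

Off `[-2, 2]` one has `‖w‖ < 1`. The free Jacobi operator minus `x` factors through
`(1 - w U*)(1 - w U)`, with `U` the shift, and is bounded below; since the potential is small near
`-∞` and large near `+∞`, `B - x` is bounded below up to a compact term. So the range of `B - x` is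
closed when `x` is not an eigenvalue, and it is dense because an orthogonal vector would be a
conjugated eigenvector.
-/

open Filter Topology

/-! ### First order recurrences on `ℤ` -/

section NormSucc

variable {E : Type*} [NormedAddCommGroup E] {f : ℤ → E}

theorem eq_zero_of_norm_succ_le_of_tendsto_atBot {N : ℤ} (h : ∀ n < N, ‖f (n + 1)‖ ≤ ‖f n‖)
    (hlim : Tendsto f atBot (𝓝 0)) {n : ℤ} (hn : n ≤ N) : f n = 0 := by
  have hanti : AntitoneOn (fun n => ‖f n‖) (Set.Iic N) :=
    antitoneOn_of_add_one_le Set.ordConnected_Iic fun k _ _ hk => h k (Int.lt_of_add_one_le hk)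
  have hnorm : Tendsto (fun k => ‖f k‖) atBot (𝓝 0) := by simpa using hlim.norm
  refine norm_le_zero_iff.mp (ge_of_tendsto hnorm ?_)
  filter_upwards [eventually_le_atBot n] with k hk
  exact hanti (hk.trans hn) hn hk

theorem eq_zero_of_mul_norm_le_norm_succ {N : ℤ} {r C : ℝ} (hr : 1 < r)
    (h : ∀ n ≥ N, r * ‖f n‖ ≤ ‖f (n + 1)‖) (hC : ∀ n, ‖f n‖ ≤ C) {n : ℤ} (hn : N ≤ n) :
    f n = 0 := by
  by_contra hne
  have hgrowth (k : ℕ) : r ^ k * ‖f n‖ ≤ ‖f (n + k)‖ := by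
    induction k with
    | zero => simp
    | succ k ih =>
      calc r ^ (k + 1) * ‖f n‖ = r * (r ^ k * ‖f n‖) := by ring
        _ ≤ r * ‖f (n + k)‖ := by gcongr
        _ ≤ ‖f (n + k + 1)‖ := h _ (by omega)
        _ = ‖f (n + (k + 1 : ℕ))‖ := by rw [Nat.cast_succ, add_assoc]
  obtain ⟨k, hk⟩ := pow_unbounded_of_one_lt (C / ‖f n‖) hr
  rw [div_lt_iff₀ (norm_pos_iff.mpr hne)] at hk
  exact (hk.trans_le ((hgrowth k).trans (hC _))).false

end NormSucc

section FirstOrder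

variable {𝕜 : Type*} [NormedField 𝕜] {a f : ℤ → 𝕜}

theorem eq_zero_of_succ_eq_mul_of_tendsto_atBot (hf : ∀ n, f (n + 1) = a n * f n) {N : ℤ}
    (ha : ∀ n < N, ‖a n‖ ≤ 1) (hlim : Tendsto f atBot (𝓝 0)) (n : ℤ) : f n = 0 := by
  have hle : ∀ n ≤ N, f n = 0 := fun n hn =>
    eq_zero_of_norm_succ_le_of_tendsto_atBot
      (fun k hk => by rw [hf, norm_mul]; exact mul_le_of_le_one_left (norm_nonneg _) (ha k hk))
      hlim hn
  rcases le_total n N with hn | hn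
  · exact hle n hn
  · induction n, hn using Int.leInduction with
    | base => exact hle N le_rfl
    | succ n _ ih => rw [hf, ih, mul_zero]

theorem eq_zero_of_succ_eq_mul_of_bounded (hf : ∀ n, f (n + 1) = a n * f n) (ha : ∀ n, a n ≠ 0)
    (hlim : Tendsto (fun n => ‖a n‖) atTop atTop) {C : ℝ} (hC : ∀ n, ‖f n‖ ≤ C) (n : ℤ) :
    f n = 0 := by
  obtain ⟨N, hN⟩ := eventually_atTop.mp (hlim.eventually_ge_atTop 2)
  have hge : ∀ n ≥ N, f n = 0 := fun n hn =>
    eq_zero_of_mul_norm_le_norm_succ one_lt_two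
      (fun k hk => by rw [hf, norm_mul]; gcongr; exact hN k hk) hC hn
  rcases le_total N n with hn | hn
  · exact hge n hn
  · induction n, hn using Int.leInductionDown with
    | base => exact hge N le_rfl
    | pred n _ ih =>
      have h := hf (n - 1)
      rw [sub_add_cancel, ih] at h
      exact (mul_eq_zero.mp h.symm).resolve_left (ha _)

end FirstOrder

section Geometric

variable {𝕜 : Type*} [NormedField 𝕜] {q : 𝕜}

theorem norm_mul_lt_one {u : 𝕜} (hq : ‖q‖ < 1) (hu : ‖u‖ ≤ 1) : ‖q * u‖ < 1 := by
  rw [norm_mul]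
  exact mul_lt_one_of_nonneg_of_lt_one_left (norm_nonneg _) hq hu

theorem tendsto_norm_zpow_neg_atTop (hq0 : q ≠ 0) (hq1 : ‖q‖ < 1) :
    Tendsto (fun n : ℤ => ‖q ^ (-n)‖) atTop atTop := by
  have hinv : 1 < ‖q‖⁻¹ := (one_lt_inv₀ (norm_pos_iff.mpr hq0)).mpr hq1
  refine tendsto_atTop.mpr fun C => ?_
  obtain ⟨k, hk⟩ := pow_unbounded_of_one_lt C hinv
  filter_upwards [eventually_ge_atTop (k : ℤ)] with n hn
  rw [norm_zpow, ← inv_zpow']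
  refine hk.le.trans ?_
  rw [← zpow_natCast]
  exact zpow_le_zpow_right₀ hinv.le hn

theorem tendsto_zpow_neg_atBot (hq0 : q ≠ 0) (hq1 : ‖q‖ < 1) :
    Tendsto (fun n : ℤ => q ^ (-n)) atBot (𝓝 0) := by
  rw [tendsto_zero_iff_norm_tendsto_zero]
  have h := ((tendsto_norm_zpow_neg_atTop hq0 hq1).comp tendsto_neg_atBot_atTop).inv_tendsto_atTop
  refine h.congr fun n => ?_
  simp

theorem one_sub_pow_succ_ne_zero (hq : ‖q‖ < 1) (k : ℕ) : 1 - q ^ (k + 1) ≠ 0 := by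
  intro h
  have h1 : ‖q‖ ^ (k + 1) = 1 := by rw [← norm_pow, ← sub_eq_zero.mp h, norm_one]
  exact (pow_lt_one₀ (norm_nonneg q) hq k.succ_ne_zero).ne h1

theorem tendsto_one_sub_pow_succ (hq : ‖q‖ < 1) :
    Tendsto (fun k : ℕ => 1 - q ^ (k + 1)) atTop (𝓝 1) := by
  simpa using ((tendsto_pow_atTop_nhds_zero_of_norm_lt_one hq).comp
    (tendsto_add_atTop_nat 1)).const_sub 1

theorem summable_of_succ_eq_mul_of_tendsto [CompleteSpace 𝕜] {f g : ℕ → 𝕜} {l : 𝕜} (hl : ‖l‖ < 1)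
    (hg : Tendsto g atTop (𝓝 l)) (h : ∀ k, f (k + 1) = g k * f k) : Summable f := by
  obtain ⟨r, hlr, hr⟩ := exists_between hl
  refine summable_of_ratio_norm_eventually_le hr ?_
  filter_upwards [hg.norm.eventually (gt_mem_nhds hlr)] with k hk
  rw [h, norm_mul]
  exact mul_le_mul_of_nonneg_right hk.le (norm_nonneg _)

end Geometric

/-! ### Second order recurrences on `ℤ` -/

/-- `ψ` solves the discrete Schrödinger equation with potential `V` at the energy `x`. -/
def IsSchrodingerSol {R : Type*} [CommRing R] (V : ℤ → R) (x : R) (ψ : ℤ → R) : Prop :=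
  ∀ n : ℤ, ψ (n - 1) + V n * ψ n + ψ (n + 1) = x * ψ n

/-- The Casoratian (discrete Wronskian) of two sequences. -/
def casoratian {R : Type*} [CommRing R] (φ ψ : ℤ → R) (n : ℤ) : R :=
  φ n * ψ (n + 1) - φ (n + 1) * ψ n

namespace IsSchrodingerSol

section CommRing

variable {R : Type*} [CommRing R] {V φ ψ : ℤ → R} {x : R}

theorem const_mul (c : R) (hψ : IsSchrodingerSol V x ψ) :
    IsSchrodingerSol V x fun n => c * ψ n := fun n => by
  linear_combination c * hψ n

theorem sub (hφ : IsSchrodingerSol V x φ) (hψ : IsSchrodingerSol V x ψ) :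
    IsSchrodingerSol V x fun n => φ n - ψ n := fun n => by
  linear_combination hφ n - hψ n

theorem casoratian_succ (hφ : IsSchrodingerSol V x φ) (hψ : IsSchrodingerSol V x ψ) (n : ℤ) :
    casoratian φ ψ (n + 1) = casoratian φ ψ n := by
  have eφ := hφ (n + 1)
  have eψ := hψ (n + 1)
  simp only [add_sub_cancel_right] at eφ eψ
  simp only [casoratian]
  linear_combination φ (n + 1) * eψ - ψ (n + 1) * eφ

theorem eq_zero_of_apply_eq_zero (hψ : IsSchrodingerSol V x ψ) {k : ℤ} (h0 : ψ k = 0)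
    (h1 : ψ (k + 1) = 0) (n : ℤ) : ψ n = 0 := by
  have hup (j : ℕ) : ψ (k + j) = 0 ∧ ψ (k + j + 1) = 0 := by
    induction j with
    | zero => simpa using ⟨h0, h1⟩
    | succ j ih =>
      have e := hψ (k + j + 1)
      rw [add_sub_cancel_right, ih.1, ih.2] at e
      push_cast
      rw [← add_assoc]
      exact ⟨ih.2, by linear_combination e⟩
  have hdown (j : ℕ) : ψ (k - j) = 0 ∧ ψ (k - j + 1) = 0 := by
    induction j with
    | zero => simpa using ⟨h0, h1⟩
    | succ j ih =>
      have e := hψ (k - j)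
      rw [ih.1, ih.2] at e
      push_cast
      rw [← sub_sub, sub_add_cancel]
      exact ⟨by linear_combination e, ih.1⟩
  rcases le_total k n with h | h
  · obtain ⟨j, rfl⟩ := Int.le.dest h
    exact (hup j).1
  · obtain ⟨j, hj⟩ := Int.le.dest h
    rw [show n = k - j by omega]
    exact (hdown j).1

end CommRing

theorem casoratian_eq_zero_of_tendsto {𝕜 : Type*} [NormedField 𝕜] {V φ ψ : ℤ → 𝕜} {x : 𝕜}
    (hφ : IsSchrodingerSol V x φ) (hψ : IsSchrodingerSol V x ψ)
    (hφ0 : Tendsto φ atBot (𝓝 0)) (hψ0 : Tendsto ψ atBot (𝓝 0)) (n : ℤ) :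
    casoratian φ ψ n = 0 := by
  have hshift : Tendsto (fun n : ℤ => n + 1) atBot atBot :=
    tendsto_atBot_add_const_right _ 1 tendsto_id
  have hlim : Tendsto (casoratian φ ψ) atBot (𝓝 0) := by
    unfold casoratian
    simpa using
      (hφ0.mul (hψ0.comp hshift)).sub ((hφ0.comp hshift).mul hψ0)
  exact eq_zero_of_norm_succ_le_of_tendsto_atBot (N := n)
    (fun k _ => (congrArg norm (casoratian_succ hφ hψ k)).le) hlim le_rfl

theorem exists_eq_mul {𝕜 : Type*} [Field 𝕜] {V φ ψ : ℤ → 𝕜} {x : 𝕜}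
    (hφ : IsSchrodingerSol V x φ) (hψ : IsSchrodingerSol V x ψ)
    (hW : ∀ n, casoratian φ ψ n = 0) {k : ℤ} (hk : φ k ≠ 0) : ∃ c, ∀ n, ψ n = c * φ n := by
  refine ⟨ψ k / φ k, fun n => sub_eq_zero.mp ?_⟩
  refine (hψ.sub (hφ.const_mul (ψ k / φ k))).eq_zero_of_apply_eq_zero (k := k) ?_ ?_ n
  · field_simp
    ring
  · have h := hW k
    rw [casoratian] at h
    field_simp
    linear_combination h

end IsSchrodingerSol

/-! ### Division by `(uz; q)_∞` -/

theorem qPoch_succ (a q : ℂ) (k : ℕ) : qPoch a q (k + 1) = qPoch a q k * (1 - a * q ^ k) :=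
  Finset.prod_range_succ _ _

theorem qPoch_self_ne_zero {q : ℂ} (hq : ‖q‖ < 1) (k : ℕ) : qPoch q q k ≠ 0 :=
  Finset.prod_ne_zero_iff.mpr fun i _ => by
    rw [← pow_succ']; exact one_sub_pow_succ_ne_zero hq i

/-- The coefficients `uᵏ / (q; q)ₖ` of the `q`-exponential series `1 / (uz; q)_∞`. -/
noncomputable def qExpCoeff (q u : ℂ) (k : ℕ) : ℂ := u ^ k / qPoch q q k

/-- Convolution of a two-sided sequence with the coefficients of `1 / (uz; q)_∞`: on generating
functions `∑ φ n zⁿ`, division by `(uz; q)_∞`. -/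
noncomputable def qExpConv (q u : ℂ) (φ : ℤ → ℂ) (n : ℤ) : ℂ :=
  ∑' k : ℕ, qExpCoeff q u k * φ (n - k)

theorem qExpCoeff_zero (q u : ℂ) : qExpCoeff q u 0 = 1 := by simp [qExpCoeff, qPoch]

theorem qExpCoeff_mul (q c u : ℂ) (k : ℕ) : qExpCoeff q (c * u) k = c ^ k * qExpCoeff q u k := by
  rw [qExpCoeff, qExpCoeff, mul_pow, mul_div_assoc]

theorem one_sub_mul_qExpCoeff_succ {q : ℂ} (hq : ‖q‖ < 1) (u : ℂ) (k : ℕ) :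
    (1 - q ^ (k + 1)) * qExpCoeff q u (k + 1) = u * qExpCoeff q u k := by
  have h1 := one_sub_pow_succ_ne_zero hq k
  have h2 := qPoch_self_ne_zero hq k
  rw [qExpCoeff, qExpCoeff, qPoch_succ, ← pow_succ']
  field_simp
  ring

theorem summable_qExpCoeff {q u : ℂ} (hq : ‖q‖ < 1) (hu : ‖u‖ < 1) :
    Summable (qExpCoeff q u) := by
  have h : Tendsto (fun k : ℕ => u / (1 - q ^ (k + 1))) atTop (𝓝 u) := by
    simpa [div_eq_mul_inv] using ((tendsto_one_sub_pow_succ hq).inv₀ one_ne_zero).const_mul u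
  refine summable_of_succ_eq_mul_of_tendsto hu h fun k => ?_
  rw [div_mul_eq_mul_div, ← one_sub_mul_qExpCoeff_succ hq,
    mul_div_cancel_left₀ _ (one_sub_pow_succ_ne_zero hq k)]

theorem summable_qExpConv {q u : ℂ} {φ : ℤ → ℂ} (hq : ‖q‖ < 1) (hu : ‖u‖ < 1) (hφ : Summable φ) :
    Summable (qExpConv q u φ) := by
  let shear : ℤ × ℕ ≃ ℤ × ℕ :=
    { toFun := fun p => (p.1 - p.2, p.2)
      invFun := fun p => (p.1 + p.2, p.2)
      left_inv := fun p => by simp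
      right_inv := fun p => by simp }
  have hprod := summable_mul_of_summable_norm hφ.norm (summable_qExpCoeff hq hu).norm
  refine (shear.summable_iff.mpr hprod).prod.congr fun n => tsum_congr fun k => ?_
  simp [shear, mul_comm]

theorem zpow_mul_qExpConv {q : ℂ} (hq0 : q ≠ 0) (u : ℂ) (φ : ℤ → ℂ) (n : ℤ) :
    q ^ n * qExpConv q u φ n = qExpConv q (q * u) (fun k => q ^ k * φ k) n := by
  rw [qExpConv, qExpConv, ← tsum_mul_left]
  refine tsum_congr fun k => ?_
  have hpow : q ^ n = q ^ k * q ^ (n - k) := by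
    rw [← zpow_natCast, ← zpow_add₀ hq0, add_sub_cancel]
  rw [qExpCoeff_mul, hpow]
  ring

section Bounded

variable {q u : ℂ} {φ : ℤ → ℂ} {M : ℝ}

theorem summable_norm_qExpCoeff_mul (hq : ‖q‖ < 1) (hu : ‖u‖ < 1) (hφ : ∀ n, ‖φ n‖ ≤ M) (n : ℤ) :
    Summable fun k : ℕ => ‖qExpCoeff q u k * φ (n - k)‖ := by
  refine ((summable_qExpCoeff hq hu).norm.mul_right M).of_nonneg_of_le
    (fun _ => norm_nonneg _) fun k => ?_
  rw [norm_mul]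
  exact mul_le_mul_of_nonneg_left (hφ _) (norm_nonneg _)

theorem hasSum_qExpConv (hq : ‖q‖ < 1) (hu : ‖u‖ < 1) (hφ : ∀ n, ‖φ n‖ ≤ M) (n : ℤ) :
    HasSum (fun k : ℕ => qExpCoeff q u k * φ (n - k)) (qExpConv q u φ n) :=
  (summable_norm_qExpCoeff_mul hq hu hφ n).of_norm.hasSum

theorem exists_norm_qExpConv_le (hq : ‖q‖ < 1) (hu : ‖u‖ < 1) (hφ : ∀ n, ‖φ n‖ ≤ M) :
    ∃ C, ∀ n, ‖qExpConv q u φ n‖ ≤ C := by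
  refine ⟨∑' k, ‖qExpCoeff q u k‖ * M, fun n => ?_⟩
  refine (norm_tsum_le_tsum_norm (summable_norm_qExpCoeff_mul hq hu hφ n)).trans ?_
  refine (summable_norm_qExpCoeff_mul hq hu hφ n).tsum_le_tsum (fun k => ?_)
    ((summable_qExpCoeff hq hu).norm.mul_right M)
  rw [norm_mul]
  exact mul_le_mul_of_nonneg_left (hφ _) (norm_nonneg _)

theorem tendsto_qExpConv_atBot (hq : ‖q‖ < 1) (hu : ‖u‖ < 1) (hφ : ∀ n, ‖φ n‖ ≤ M)
    (h : Tendsto φ atBot (𝓝 0)) : Tendsto (qExpConv q u φ) atBot (𝓝 0) := by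
  have : Tendsto (qExpConv q u φ) atBot (𝓝 (∑' _ : ℕ, (0 : ℂ))) := by
    refine tendsto_tsum_of_dominated_convergence ((summable_qExpCoeff hq hu).norm.mul_right M) ?_ ?_
    · intro k
      have hshift : Tendsto (fun n : ℤ => n - (k : ℤ)) atBot atBot :=
        tendsto_atBot_add_const_right _ (-(k : ℤ)) tendsto_id
      simpa using (h.comp hshift).const_mul (qExpCoeff q u k)
    · refine Eventually.of_forall fun n k => ?_
      rw [norm_mul]
      exact mul_le_mul_of_nonneg_left (hφ _) (norm_nonneg _)
  simpa using this

/-- Comparison of coefficients in `(1 - uz) / (uz; q)_∞ = 1 / (quz; q)_∞`. -/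
theorem qExpConv_sub_mul_qExpConv_sub_one (hq : ‖q‖ < 1) (hu : ‖u‖ < 1) (hφ : ∀ n, ‖φ n‖ ≤ M)
    (n : ℤ) : qExpConv q u φ n - u * qExpConv q u φ (n - 1) = qExpConv q (q * u) φ n := by
  have h := (hasSum_qExpConv hq hu hφ n).summable
  have hsub := (hasSum_qExpConv hq hu hφ (n - 1)).summable.mul_left u
  have hmul := (hasSum_qExpConv hq (norm_mul_lt_one hq hu.le) hφ n).summable
  rw [qExpConv, qExpConv, qExpConv, ← tsum_mul_left, h.tsum_eq_zero_add, hmul.tsum_eq_zero_add,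
    add_sub_assoc, ← ((summable_nat_add_iff 1).mpr h).tsum_sub hsub, qExpCoeff_zero, qExpCoeff_zero]
  congr 1
  refine tsum_congr fun k => ?_
  rw [show n - ((k + 1 : ℕ) : ℤ) = n - 1 - k by push_cast; ring, qExpCoeff_mul]
  linear_combination φ (n - 1 - k) * one_sub_mul_qExpCoeff_succ hq u k

theorem tendsto_qExpConv_pow_mul (hq : ‖q‖ < 1) (hu : ‖u‖ < 1) (hφ : ∀ n, ‖φ n‖ ≤ M) (n : ℤ) :
    Tendsto (fun j : ℕ => qExpConv q (q ^ j * u) φ n) atTop (𝓝 (φ n)) := by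
  have hlim : Tendsto (fun j : ℕ => qExpConv q (q ^ j * u) φ n) atTop
      (𝓝 (∑' k : ℕ, if k = 0 then φ n else 0)) := by
    refine tendsto_tsum_of_dominated_convergence (summable_norm_qExpCoeff_mul hq hu hφ n) ?_ ?_
    · rintro (_ | k)
      · simp [qExpCoeff_zero]
      · have hpow := (tendsto_pow_atTop_nhds_zero_of_norm_lt_one hq).pow (k + 1)
        simpa [qExpCoeff_mul, mul_assoc] using
          hpow.mul_const (qExpCoeff q u (k + 1) * φ (n - ((k + 1 : ℕ) : ℤ)))
    · refine Eventually.of_forall fun j k => ?_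
      rw [qExpCoeff_mul, mul_assoc, norm_mul, norm_pow, norm_pow]
      exact mul_le_of_le_one_left (norm_nonneg _)
        (pow_le_one₀ (by positivity) (pow_le_one₀ (norm_nonneg _) hq.le))
  rwa [tsum_ite_eq] at hlim

theorem eq_zero_of_qExpConv_eq_zero (hq : ‖q‖ < 1) (hu : ‖u‖ < 1) (hφ : ∀ n, ‖φ n‖ ≤ M)
    (h : ∀ n, qExpConv q u φ n = 0) (n : ℤ) : φ n = 0 := by
  have hpow (j : ℕ) : ‖q ^ j * u‖ < 1 := by
    rw [mul_comm]
    exact norm_mul_lt_one hu (by rw [norm_pow]; exact pow_le_one₀ (norm_nonneg _) hq.le)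
  have hzero (j : ℕ) : ∀ n, qExpConv q (q ^ j * u) φ n = 0 := by
    induction j with
    | zero => simpa using h
    | succ j ih =>
      intro n
      rw [pow_succ', mul_assoc, ← qExpConv_sub_mul_qExpConv_sub_one hq (hpow j) hφ, ih, ih,
        mul_zero, sub_zero]
  have hlim := tendsto_qExpConv_pow_mul hq hu hφ n
  simp only [hzero] at hlim
  exact tendsto_nhds_unique hlim tendsto_const_nhds

theorem IsSchrodingerSol.qExpConv_add_qExpConv_add {V : ℤ → ℂ} {x : ℂ} (hq : ‖q‖ < 1)
    (hu : ‖u‖ < 1) (hφ : ∀ n, ‖φ n‖ ≤ M) (h : IsSchrodingerSol V x φ) (n : ℤ) :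
    qExpConv q u φ (n - 1) + qExpConv q u (fun k => V k * φ k) n + qExpConv q u φ (n + 1)
      = x * qExpConv q u φ n := by
  have h0 := (hasSum_qExpConv hq hu hφ n).mul_left x
  have hpred := hasSum_qExpConv hq hu hφ (n - 1)
  have hsucc := hasSum_qExpConv hq hu hφ (n + 1)
  have hV : HasSum (fun k : ℕ => qExpCoeff q u k * (V (n - k) * φ (n - k)))
      (x * qExpConv q u φ n - qExpConv q u φ (n - 1) - qExpConv q u φ (n + 1)) := by
    refine ((h0.sub hpred).sub hsucc).congr_fun fun k => ?_
    have e := h (n - k)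
    rw [show n - (k : ℤ) - 1 = n - 1 - k by ring, show n - (k : ℤ) + 1 = n + 1 - k by ring] at e
    linear_combination qExpCoeff q u k * e
  rw [show qExpConv q u (fun k => V k * φ k) n = _ from hV.tsum_eq]
  ring

end Bounded

/-! ### Uniqueness of the decaying solutions -/

/-- The potential `α q⁻ⁿ` of the operator `opB α q`. -/
noncomputable def geomPotential (α q : ℂ) (n : ℤ) : ℂ := α * q ^ (-n)

theorem geomPotential_sub_one {q : ℂ} (hq0 : q ≠ 0) (α : ℂ) (n : ℤ) :
    geomPotential α q (n - 1) = q * geomPotential α q n := by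
  rw [geomPotential, geomPotential, neg_sub, sub_eq_add_neg, zpow_one_add₀ hq0]
  ring

theorem tendsto_norm_geomPotential_atTop {α q : ℂ} (hq0 : q ≠ 0) (hq1 : ‖q‖ < 1) (hα : α ≠ 0) :
    Tendsto (fun n => ‖geomPotential α q n‖) atTop atTop := by
  simp only [geomPotential, norm_mul]
  exact (tendsto_norm_zpow_neg_atTop hq0 hq1).const_mul_atTop (norm_pos_iff.mpr hα)

theorem tendsto_geomPotential_atBot {q : ℂ} (hq0 : q ≠ 0) (hq1 : ‖q‖ < 1) (α : ℂ) :
    Tendsto (geomPotential α q) atBot (𝓝 0) := by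
  unfold geomPotential
  simpa only [mul_zero] using (tendsto_zpow_neg_atBot hq0 hq1).const_mul α

theorem qExpConv_geomPotential_mul {q u : ℂ} {φ : ℤ → ℂ} {M : ℝ} (hq0 : q ≠ 0) (hq1 : ‖q‖ < 1)
    (hu : ‖u‖ < 1) (hφ : ∀ n, ‖φ n‖ ≤ M) (α : ℂ) (n : ℤ) :
    qExpConv q u (fun k => geomPotential α q k * φ k) n
      = geomPotential α q n * (qExpConv q u φ n - u * qExpConv q u φ (n - 1)) := by
  have hcancel (k : ℤ) : q ^ k * (geomPotential α q k * φ k) = α * φ k := by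
    rw [geomPotential, zpow_neg]
    field_simp [zpow_ne_zero k hq0]
  have h := zpow_mul_qExpConv hq0 u (fun k => geomPotential α q k * φ k) n
  have hα : qExpConv q (q * u) (fun k => α * φ k) n = α * qExpConv q (q * u) φ n := by
    simp only [qExpConv, ← tsum_mul_left, mul_left_comm]
  simp only [hcancel] at h
  rw [qExpConv_sub_mul_qExpConv_sub_one hq1 hu hφ, geomPotential, zpow_neg, mul_right_comm, ← hα,
    ← h]
  field_simp [zpow_ne_zero n hq0]

namespace IsSchrodingerSol

variable {α q w : ℂ} {ψ : ℤ → ℂ} {M : ℝ}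

/-- Dividing the generating function of a decaying solution by `(qwz; q)_∞` lowers the order of
the recurrence from two to one: the defect of the first order recurrence is multiplied by `w` at
each step, and tends to zero at `-∞`. -/
theorem qExpConv_succ (hq0 : q ≠ 0) (hq1 : ‖q‖ < 1) (hw0 : w ≠ 0) (hw1 : ‖w‖ ≤ 1)
    (hM : ∀ n, ‖ψ n‖ ≤ M) (hlim : Tendsto ψ atBot (𝓝 0))
    (hψ : IsSchrodingerSol (geomPotential α q) (w + w⁻¹) ψ) (n : ℤ) :
    qExpConv q (q * w) ψ (n + 1) = (w⁻¹ - geomPotential α q n) * qExpConv q (q * w) ψ n := by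
  have hu := norm_mul_lt_one hq1 hw1
  set h := qExpConv q (q * w) ψ
  set defect : ℤ → ℂ := fun n => h (n + 1) - (w⁻¹ - geomPotential α q n) * h n with hdefect
  have hsecond (n : ℤ) : h (n - 1) + geomPotential α q n * (h n - q * w * h (n - 1)) + h (n + 1)
      = (w + w⁻¹) * h n := by
    rw [← hψ.qExpConv_add_qExpConv_add hq1 hu hM, qExpConv_geomPotential_mul hq0 hq1 hu hM]
  have hdefect_succ (n : ℤ) : defect (n + 1) = w * defect n := by
    have e := hsecond (n + 1)
    have eV := geomPotential_sub_one hq0 α (n + 1)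
    simp only [add_sub_cancel_right] at e eV
    simp only [hdefect]
    linear_combination e - w * h n * eV + h n * mul_inv_cancel₀ hw0
  have hhlim : Tendsto h atBot (𝓝 0) := tendsto_qExpConv_atBot hq1 hu hM hlim
  have hdefect_lim : Tendsto defect atBot (𝓝 0) := by
    have hsucc : Tendsto (fun n => h (n + 1)) atBot (𝓝 0) :=
      hhlim.comp (tendsto_atBot_add_const_right _ 1 tendsto_id)
    simpa using hsucc.sub (((tendsto_geomPotential_atBot hq0 hq1 α).const_sub w⁻¹).mul hhlim)
  exact sub_eq_zero.mp <| eq_zero_of_succ_eq_mul_of_tendsto_atBot (N := n) hdefect_succ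
    (fun _ _ => hw1) hdefect_lim n

theorem exists_mul_eq_zpow (hq0 : q ≠ 0) (hq1 : ‖q‖ < 1) (hα : α ≠ 0) (hw0 : w ≠ 0)
    (hw1 : ‖w‖ ≤ 1) (hM : ∀ n, ‖ψ n‖ ≤ M) (hlim : Tendsto ψ atBot (𝓝 0))
    (hψ : IsSchrodingerSol (geomPotential α q) (w + w⁻¹) ψ) (hne : ∃ n, ψ n ≠ 0) :
    ∃ m : ℤ, α * w = q ^ m := by
  by_contra! hcon
  obtain ⟨n, hn⟩ := hne
  have hu := norm_mul_lt_one hq1 hw1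
  obtain ⟨C, hC⟩ := exists_norm_qExpConv_le hq1 hu hM
  have hfactor (n : ℤ) : w⁻¹ - geomPotential α q n ≠ 0 := by
    intro h
    rw [geomPotential, zpow_neg] at h
    apply hcon n
    field_simp [zpow_ne_zero n hq0] at h
    linear_combination -h
  have hgrowth : Tendsto (fun n => ‖w⁻¹ - geomPotential α q n‖) atTop atTop := by
    refine tendsto_atTop_mono (fun n => ?_) <| tendsto_atTop_add_const_right _ (-‖w⁻¹‖)
      (tendsto_norm_geomPotential_atTop hq0 hq1 hα)
    rw [← sub_eq_add_neg, norm_sub_rev]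
    exact norm_sub_norm_le _ _
  exact hn <| eq_zero_of_qExpConv_eq_zero hq1 hu hM (eq_zero_of_succ_eq_mul_of_bounded
    (hψ.qExpConv_succ hq0 hq1 hw0 hw1 hM hlim) hfactor hgrowth hC) n

theorem norm_lt_one_of_mul_eq_zpow {q : ℝ} (hq0 : 0 < q) (hq1 : q < 1) (hw0 : w ≠ 0)
    (hw1 : ‖w‖ ≤ 1) (hM : ∀ n, ‖ψ n‖ ≤ M) (hlim : Tendsto ψ atBot (𝓝 0))
    (hψ : IsSchrodingerSol (geomPotential α q) (w + w⁻¹) ψ) (hne : ∃ n, ψ n ≠ 0) {m : ℤ}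
    (hm : α * w = (q : ℂ) ^ m) : ‖w‖ < 1 := by
  refine lt_of_le_of_ne hw1 fun hw => ?_
  obtain ⟨n, hn⟩ := hne
  have hqc0 : (q : ℂ) ≠ 0 := Complex.ofReal_ne_zero.mpr hq0.ne'
  have hqc1 : ‖(q : ℂ)‖ < 1 := by rwa [Complex.norm_of_nonneg hq0.le]
  have hu := norm_mul_lt_one hqc1 hw1
  have hfactor (n : ℤ) (hn : n < m) : ‖w⁻¹ - geomPotential α q n‖ ≤ 1 := by
    have e : w⁻¹ - geomPotential α q n = w⁻¹ * (1 - q ^ (m - n) : ℝ) := by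
      rw [geomPotential, Complex.ofReal_sub, Complex.ofReal_one, Complex.ofReal_zpow,
        sub_eq_add_neg m, zpow_add₀ hqc0, ← hm]
      field_simp
    have hpos := zpow_pos hq0 (m - n)
    have hle : q ^ (m - n) ≤ 1 := zpow_le_one₀ hq0 hq1.le (by omega)
    rw [e, norm_mul, norm_inv, hw, inv_one, one_mul, Complex.norm_of_nonneg (by linarith)]
    linarith
  exact hn <| eq_zero_of_qExpConv_eq_zero hqc1 hu hM (eq_zero_of_succ_eq_mul_of_tendsto_atBot
    (hψ.qExpConv_succ hqc0 hqc1 hw0 hw1 hM hlim) hfactor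
    (tendsto_qExpConv_atBot hqc1 hu hM hlim)) n

end IsSchrodingerSol

/-! ### The eigenvectors -/

theorem qPochInf_zpow {q : ℂ} (hq0 : q ≠ 0) (hq1 : ‖q‖ < 1) (i : ℤ) :
    qPochInf (q ^ i) q = (1 - q ^ i) * qPochInf (q ^ (i + 1)) q := by
  rw [qPochInf_eq (q ^ i) q hq1 1, pow_one, ← zpow_add_one₀ hq0]
  simp [qPoch]

theorem qPochInf_zpow_of_nonpos {q : ℂ} (hq0 : q ≠ 0) (hq1 : ‖q‖ < 1) {i : ℤ} (hi : i ≤ 0) :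
    qPochInf (q ^ i) q = 0 := by
  induction i, hi using Int.leInductionDown with
  | base => rw [qPochInf_zpow hq0 hq1, zpow_zero, sub_self, zero_mul]
  | pred i _ ih => rw [qPochInf_zpow hq0 hq1, sub_add_cancel, ih, mul_zero]

theorem qPochInf_self_ne_zero {q : ℂ} (hq : ‖q‖ < 1) : qPochInf q q ≠ 0 := by
  have h : qPochInf q q = ∏' i : ℕ, (1 + -(q ^ (i + 1))) :=
    tprod_congr fun i => by rw [pow_succ', sub_eq_add_neg]
  rw [h]
  refine tprod_one_add_ne_zero_of_summable (fun i => ?_) ?_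
  · rw [← sub_eq_add_neg]
    exact one_sub_pow_succ_ne_zero hq i
  · simp only [norm_neg, norm_pow]
    exact (summable_nat_add_iff 1).mpr (summable_geometric_of_lt_one (norm_nonneg _) hq)

theorem two_mul_triangle (n : ℤ) : 2 * (n * (n + 1) / 2) = n * (n + 1) :=
  Int.mul_ediv_cancel' (Int.even_mul_succ_self n).two_dvd

/-- The coefficient of `zⁿ` in `(q; q)_∞ (qw/z; q)_∞`. As `(q^{-n+1}; q)_∞` vanishes for `n > 0`
and equals `(q; q)_∞ / (q; q)₋ₙ` for `n ≤ 0`, one formula covers both signs of `n`. -/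
noncomputable def bigQExpCoeff (q w : ℂ) (n : ℤ) : ℂ :=
  qPochInf (q ^ (-n + 1)) q * (-w) ^ (-n) * q ^ (-n * (-n + 1) / 2)

section BigQExp

variable {q w : ℂ}

theorem zpow_mul_bigQExpCoeff (hq0 : q ≠ 0) (hq1 : ‖q‖ < 1) (hw : w ≠ 0) (n : ℤ) :
    q ^ n * bigQExpCoeff q w n = bigQExpCoeff q w n - w * bigQExpCoeff q w (n + 1) := by
  have hindex : -(n + 1) + 1 = -n := by ring
  have hsign : (-w) ^ (-n) = (-w) ^ (-(n + 1)) * (-w) := by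
    rw [← zpow_add_one₀ (neg_ne_zero.mpr hw), hindex]
  have htriangle : q ^ (-n * (-n + 1) / 2) = q ^ (-(n + 1) * (-(n + 1) + 1) / 2) * q ^ (-n) := by
    rw [← zpow_add₀ hq0]
    congr 1
    linarith [two_mul_triangle (-n), two_mul_triangle (-(n + 1))]
  have hcancel : q ^ n * q ^ (-n) = 1 := by rw [← zpow_add₀ hq0, add_neg_cancel, zpow_zero]
  rw [bigQExpCoeff, bigQExpCoeff, htriangle, hsign, hindex, qPochInf_zpow hq0 hq1 (-n)]
  linear_combination (-w * (-w) ^ (-(n + 1)) * q ^ (-(n + 1) * -n / 2) *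
    qPochInf (q ^ (-n + 1)) q) * hcancel

theorem bigQExpCoeff_of_pos (hq0 : q ≠ 0) (hq1 : ‖q‖ < 1) {n : ℤ} (hn : 0 < n) :
    bigQExpCoeff q w n = 0 := by
  rw [bigQExpCoeff, qPochInf_zpow_of_nonpos hq0 hq1 (by omega), zero_mul, zero_mul]

theorem bigQExpCoeff_zero_ne_zero (hq : ‖q‖ < 1) : bigQExpCoeff q w 0 ≠ 0 := by
  simpa [bigQExpCoeff] using qPochInf_self_ne_zero hq

theorem bigQExpCoeff_neg_succ (hq0 : q ≠ 0) (hq1 : ‖q‖ < 1) (hw : w ≠ 0) (k : ℕ) :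
    bigQExpCoeff q w (-(k + 1 : ℕ))
      = -(w * q ^ (k + 1)) * (1 - q ^ (k + 1))⁻¹ * bigQExpCoeff q w (-k) := by
  have hrec := zpow_mul_bigQExpCoeff hq0 hq1 hw (-(k + 1 : ℕ))
  have hne := one_sub_pow_succ_ne_zero hq1 k
  have hpow : q ^ (k + 1) ≠ 0 := pow_ne_zero _ hq0
  rw [zpow_neg, zpow_natCast, show -((k + 1 : ℕ) : ℤ) + 1 = -k by push_cast; ring] at hrec
  field_simp at hrec ⊢
  linear_combination hrec

theorem summable_bigQExpCoeff (hq0 : q ≠ 0) (hq1 : ‖q‖ < 1) (hw : w ≠ 0) :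
    Summable (bigQExpCoeff q w) := by
  have hinj : Function.Injective fun k : ℕ => -(k : ℤ) := fun a b h => by simpa using h
  rw [← hinj.summable_iff fun n hn => bigQExpCoeff_of_pos hq0 hq1 <|
    not_le.mp fun h => hn ⟨(-n).toNat, by simp only; omega⟩]
  have hratio : Tendsto (fun k : ℕ => -(w * q ^ (k + 1)) * (1 - q ^ (k + 1))⁻¹) atTop (𝓝 0) := by
    have hpow := (tendsto_pow_atTop_nhds_zero_of_norm_lt_one hq1).comp (tendsto_add_atTop_nat 1)
    simpa using (hpow.const_mul w).neg.mul ((tendsto_one_sub_pow_succ hq1).inv₀ one_ne_zero)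
  exact summable_of_succ_eq_mul_of_tendsto (by simp) hratio (bigQExpCoeff_neg_succ hq0 hq1 hw)

theorem exists_norm_bigQExpCoeff_le (hq0 : q ≠ 0) (hq1 : ‖q‖ < 1) (hw : w ≠ 0) :
    ∃ M, ∀ n, ‖bigQExpCoeff q w n‖ ≤ M :=
  ⟨_, fun n => (summable_bigQExpCoeff hq0 hq1 hw).norm.le_tsum n fun _ _ => norm_nonneg _⟩

theorem isSchrodingerSol_qExpConv_bigQExpCoeff (hq0 : q ≠ 0) (hq1 : ‖q‖ < 1) (hw0 : w ≠ 0)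
    (hw1 : ‖w‖ < 1) :
    IsSchrodingerSol (fun n => w⁻¹ * q ^ n) (w + w⁻¹) (qExpConv q w (bigQExpCoeff q w)) := by
  intro n
  obtain ⟨M, hM⟩ := exists_norm_bigQExpCoeff_le hq0 hq1 hw0
  have hqw := norm_mul_lt_one hq1 hw1.le
  have hlinear : qExpConv q (q * w) (fun n => bigQExpCoeff q w n - w * bigQExpCoeff q w (n + 1)) n
      = qExpConv q (q * w) (bigQExpCoeff q w) n
        - w * qExpConv q (q * w) (bigQExpCoeff q w) (n + 1) := by
    refine (((hasSum_qExpConv hq1 hqw hM n).sub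
      ((hasSum_qExpConv hq1 hqw hM (n + 1)).mul_left w)).congr_fun fun k => ?_).tsum_eq
    beta_reduce
    rw [sub_add_eq_add_sub]
    ring
  have h := zpow_mul_qExpConv hq0 w (bigQExpCoeff q w) n
  simp only [zpow_mul_bigQExpCoeff hq0 hq1 hw0] at h
  rw [hlinear, ← qExpConv_sub_mul_qExpConv_sub_one hq1 hw1 hM,
    ← qExpConv_sub_mul_qExpConv_sub_one hq1 hw1 hM, add_sub_cancel_right] at h
  field_simp
  linear_combination h

end BigQExp

theorem IsSchrodingerSol.comp_const_sub {R : Type*} [CommRing R] {V ψ : ℤ → R} {x : R}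
    (hψ : IsSchrodingerSol V x ψ) (m : ℤ) :
    IsSchrodingerSol (fun n => V (m - n)) x fun n => ψ (m - n) := fun n => by
  beta_reduce
  rw [← hψ (m - n), sub_sub, sub_sub_eq_add_sub, add_sub_right_comm]
  ring

theorem two_mul_cast_choose_two (k : ℕ) : 2 * (k.choose 2 : ℤ) = k * (k - 1) := by
  induction k with
  | zero => simp
  | succ k ih =>
    rw [Nat.choose_succ_succ', Nat.choose_one_right]
    push_cast
    linear_combination ih

theorem triangle_add_choose_two_add (m i : ℤ) (k : ℕ) {j : ℤ} (hj : j = m + i - k) :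
    j * (j + 1) / 2 + k.choose 2 + (m + j + 1) * k
      = m * (m + 1) / 2 + m * k + (m * i + i * (i + 1) / 2) := by
  have h : j * (j + 1) + k * (k - 1) + 2 * ((m + j + 1) * k)
      = m * (m + 1) + i * (i + 1) + 2 * (m * i) + 2 * (m * k) := by
    rw [hj]
    ring
  linarith [two_mul_triangle j, two_mul_triangle m, two_mul_triangle i, two_mul_cast_choose_two k]

theorem eigvec_monomial_eq {K : Type*} [Field K] {α q : K} (hq : q ≠ 0) (hα : α ≠ 0) (m i : ℤ)
    (k : ℕ) {j : ℤ} (hj : j = m + i - k) :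
    (-1) ^ j * α ^ (-j) * q ^ (j * (j + 1) / 2) *
        ((-1) ^ k * q ^ k.choose 2 * (α ^ (-2 : ℤ) * q ^ (m + j + 1)) ^ k)
      = (-1) ^ m * α ^ (-m) * q ^ (m * (m + 1) / 2) *
        ((α⁻¹ * q ^ m) ^ k * ((-(α⁻¹ * q ^ m)) ^ i * q ^ (i * (i + 1) / 2))) := by
  have hsign : (-1 : K) ^ j * (-1) ^ k = (-1) ^ m * (-1) ^ i := by
    have h1 : (-1 : K) ≠ 0 := neg_ne_zero.mpr one_ne_zero
    rw [← zpow_natCast, ← zpow_add₀ h1, ← zpow_add₀ h1, hj, sub_add_cancel]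
  have hαpow : α ^ (-j) * (α ^ (-2 : ℤ)) ^ k = α ^ (-m) * (α⁻¹ ^ k * α⁻¹ ^ i) := by
    simp only [← zpow_natCast, ← zpow_mul, inv_zpow', ← zpow_add₀ hα, hj]
    congr 1
    ring
  have hqpow : q ^ (j * (j + 1) / 2) * (q ^ k.choose 2 * (q ^ (m + j + 1)) ^ k)
      = q ^ (m * (m + 1) / 2) * ((q ^ m) ^ k * ((q ^ m) ^ i * q ^ (i * (i + 1) / 2))) := by
    simp only [← zpow_natCast, ← zpow_mul, ← zpow_add₀ hq]
    congr 1
    linear_combination triangle_add_choose_two_add m i k hj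
  rw [neg_eq_neg_one_mul (α⁻¹ * q ^ m), mul_zpow, mul_zpow, mul_pow, mul_pow]
  calc _ = ((-1) ^ j * (-1) ^ k) * (α ^ (-j) * (α ^ (-2 : ℤ)) ^ k) *
        (q ^ (j * (j + 1) / 2) * (q ^ k.choose 2 * (q ^ (m + j + 1)) ^ k)) := by ring
    _ = _ := by rw [hsign, hαpow, hqpow]; ring

theorem eigvalB_eq_add_inv (α q : ℝ) (m : ℤ) :
    eigvalB α q m = (α : ℂ)⁻¹ * (q : ℂ) ^ m + ((α : ℂ)⁻¹ * (q : ℂ) ^ m)⁻¹ := by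
  rw [eigvalB, mul_inv, inv_inv, zpow_neg]

section EigvecB

variable {α q : ℝ}

theorem eigvecB_eq_mul_qExpConv (hq0 : q ≠ 0) (hα : α ≠ 0) (m j : ℤ) :
    eigvecB α q m j = (-1) ^ m * (α : ℂ) ^ (-m) * (q : ℂ) ^ (m * (m + 1) / 2) *
      qExpConv q ((α : ℂ)⁻¹ * (q : ℂ) ^ m) (bigQExpCoeff q ((α : ℂ)⁻¹ * (q : ℂ) ^ m)) (m - j) := by
  have hqc : (q : ℂ) ≠ 0 := Complex.ofReal_ne_zero.mpr hq0
  have hαc : (α : ℂ) ≠ 0 := Complex.ofReal_ne_zero.mpr hα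
  rw [eigvecB, regPhiOneOne, qExpConv, ← tsum_mul_left, ← tsum_mul_left]
  refine tsum_congr fun k => ?_
  have hpoch : qPoch 0 q k = 1 := by simp [qPoch]
  have harg : (q : ℂ) ^ (-m + j + 1) * (q : ℂ) ^ k = (q : ℂ) ^ (-(m - j - k) + 1) := by
    rw [← zpow_natCast, ← zpow_add₀ hqc]
    congr 1
    ring
  rw [bigQExpCoeff, qExpCoeff, hpoch, harg]
  linear_combination (qPochInf ((q : ℂ) ^ (-(m - j - k) + 1)) q / qPoch q q k) *
    eigvec_monomial_eq hqc hαc m (-(m - j - k)) k (j := j) (by ring)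

variable {m : ℤ}

theorem isSchrodingerSol_eigvecB (hq0 : q ≠ 0) (hq1 : ‖(q : ℂ)‖ < 1) (hα : α ≠ 0)
    (hw : ‖(α : ℂ)⁻¹ * (q : ℂ) ^ m‖ < 1) :
    IsSchrodingerSol (geomPotential α q) (eigvalB α q m) (eigvecB α q m) := by
  have hqc : (q : ℂ) ≠ 0 := Complex.ofReal_ne_zero.mpr hq0
  have hαc : (α : ℂ) ≠ 0 := Complex.ofReal_ne_zero.mpr hα
  have hw0 : (α : ℂ)⁻¹ * (q : ℂ) ^ m ≠ 0 := mul_ne_zero (inv_ne_zero hαc) (zpow_ne_zero _ hqc)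
  have hV : geomPotential α q
      = fun j : ℤ => ((α : ℂ)⁻¹ * (q : ℂ) ^ m)⁻¹ * (q : ℂ) ^ (m - j) := by
    funext j
    rw [geomPotential, zpow_sub₀ hqc, zpow_neg]
    field_simp
  rw [eigvalB_eq_add_inv, funext (eigvecB_eq_mul_qExpConv hq0 hα m), hV]
  exact ((isSchrodingerSol_qExpConv_bigQExpCoeff hqc hq1 hw0 hw).comp_const_sub m).const_mul _

theorem summable_eigvecB (hq0 : q ≠ 0) (hq1 : ‖(q : ℂ)‖ < 1) (hα : α ≠ 0)
    (hw : ‖(α : ℂ)⁻¹ * (q : ℂ) ^ m‖ < 1) : Summable (eigvecB α q m) := by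
  have hqc : (q : ℂ) ≠ 0 := Complex.ofReal_ne_zero.mpr hq0
  have hαc : (α : ℂ) ≠ 0 := Complex.ofReal_ne_zero.mpr hα
  have hw0 : (α : ℂ)⁻¹ * (q : ℂ) ^ m ≠ 0 := mul_ne_zero (inv_ne_zero hαc) (zpow_ne_zero _ hqc)
  have h := summable_qExpConv hq1 hw (summable_bigQExpCoeff hqc hq1 hw0)
  rw [funext (eigvecB_eq_mul_qExpConv hq0 hα m)]
  exact ((Equiv.subLeft m).summable_iff.mpr h).mul_left _

theorem exists_eigvecB_ne_zero (hq0 : q ≠ 0) (hq1 : ‖(q : ℂ)‖ < 1) (hα : α ≠ 0)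
    (hw : ‖(α : ℂ)⁻¹ * (q : ℂ) ^ m‖ < 1) : ∃ j, eigvecB α q m j ≠ 0 := by
  have hqc : (q : ℂ) ≠ 0 := Complex.ofReal_ne_zero.mpr hq0
  have hαc : (α : ℂ) ≠ 0 := Complex.ofReal_ne_zero.mpr hα
  have hw0 : (α : ℂ)⁻¹ * (q : ℂ) ^ m ≠ 0 := mul_ne_zero (inv_ne_zero hαc) (zpow_ne_zero _ hqc)
  by_contra! hcon
  obtain ⟨M, hM⟩ := exists_norm_bigQExpCoeff_le hqc hq1 hw0
  refine bigQExpCoeff_zero_ne_zero hq1 (eq_zero_of_qExpConv_eq_zero hq1 hw hM (fun n => ?_) 0)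
  have h := hcon (m - n)
  rw [eigvecB_eq_mul_qExpConv hq0 hα, sub_sub_cancel] at h
  exact (mul_eq_zero.mp h).resolve_left (by simp [hαc, hqc, zpow_ne_zero])

end EigvecB

/-! ### Unbounded operators -/

theorem exists_norm_eq_one_tendsto_zero {𝕜 E F : Type*} [RCLike 𝕜] [NormedAddCommGroup E]
    [NormedSpace 𝕜 E] [NormedAddCommGroup F] [NormedSpace 𝕜 F] (A : E →ₗ[𝕜] F)
    (hA : ∀ C : ℝ, ∃ ψ, C * ‖A ψ‖ < ‖ψ‖) :
    ∃ f : ℕ → E, (∀ k, ‖f k‖ = 1) ∧ Tendsto (fun k => A (f k)) atTop (𝓝 0) := by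
  have hunit (k : ℕ) : ∃ ψ, ‖ψ‖ = 1 ∧ ‖A ψ‖ ≤ 1 / ((k : ℝ) + 1) := by
    obtain ⟨ψ, hψ⟩ := hA (k + 1)
    have hpos : 0 < ‖ψ‖ := lt_of_le_of_lt (by positivity) hψ
    refine ⟨(‖ψ‖⁻¹ : 𝕜) • ψ, norm_smul_inv_norm (norm_pos_iff.mp hpos), ?_⟩
    rw [map_smul, norm_smul, norm_inv, RCLike.norm_coe_norm, inv_mul_le_iff₀ hpos, mul_one_div,
      le_div_iff₀ (by positivity), mul_comm]
    exact hψ.le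
  choose f hf1 hf0 using hunit
  exact ⟨f, hf1, squeeze_zero_norm hf0 tendsto_one_div_add_atTop_nhds_zero_nat⟩

section UnboundedOperators

variable {H : Type*} [NormedAddCommGroup H] [InnerProductSpace ℂ H] {T : H →ₗ.[ℂ] H} {x : ℂ}

/-- The operator `T - x`, as a linear map on the domain of `T`. -/
def opSub (T : H →ₗ.[ℂ] H) (x : ℂ) : T.domain →ₗ[ℂ] H :=
  T.toFun - x • T.domain.subtype

theorem opSub_apply (ψ : T.domain) : opSub T x ψ = T ψ - x • (ψ : H) := rfl

theorem mem_opEigenspace_of_opSub_eq_zero {ψ : T.domain} (h : opSub T x ψ = 0) :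
    (ψ : H) ∈ opEigenspace T x :=
  ⟨ψ, h, rfl⟩

theorem pointSpectrum_subset_opSpectrum (T : H →ₗ.[ℂ] H) : pointSpectrum T ⊆ opSpectrum T := by
  rintro x hx ⟨R, -, hR⟩
  refine hx ((Submodule.eq_bot_iff _).mpr fun ψ hψ => ?_)
  obtain ⟨hd, h⟩ := (mem_opEigenspace_iff T x ψ).mp hψ
  simpa [h] using (hR ⟨ψ, hd⟩).symm

section Closed

variable {F : Type*} [NormedAddCommGroup F] [NormedSpace ℂ F] {K : H →L[ℂ] F} {C : ℝ}

theorem exists_opSub_eq_of_tendsto (hT : T.IsClosed) {f : ℕ → T.domain} {ψ η : H}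
    (hψ : Tendsto (fun k => (f k : H)) atTop (𝓝 ψ))
    (hη : Tendsto (fun k => opSub T x (f k)) atTop (𝓝 η)) :
    ∃ h : ψ ∈ T.domain, opSub T x ⟨ψ, h⟩ = η := by
  have hTf : Tendsto (fun k => T (f k)) atTop (𝓝 (η + x • ψ)) := by
    simpa [opSub_apply] using hη.add (hψ.const_smul x)
  have hgraph : (ψ, η + x • ψ) ∈ T.graph :=
    IsClosed.mem_of_tendsto hT (hψ.prodMk_nhds hTf) (.of_forall fun k => T.mem_graph (f k))
  obtain ⟨φ, rfl, hφ⟩ := T.mem_graph_iff.mp hgraph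
  exact ⟨φ.2, by rw [opSub_apply, hφ, add_sub_cancel_right]⟩

variable [CompleteSpace H]

theorem exists_tendsto_of_norm_le_mul_add (hT : T.IsClosed)
    (hC : ∀ ψ : T.domain, ‖(ψ : H)‖ ≤ C * (‖opSub T x ψ‖ + ‖K ψ‖)) {f : ℕ → T.domain} {η : H}
    (hη : Tendsto (fun k => opSub T x (f k)) atTop (𝓝 η)) (hK : CauchySeq fun k => K (f k)) :
    ∃ ψ : T.domain, Tendsto (fun k => (f k : H)) atTop (𝓝 ψ) ∧ opSub T x ψ = η := by
  have hcauchy : CauchySeq fun k => (f k : H) := by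
    have hlim := ((cauchySeq_iff_tendsto_dist_atTop_0.mp hη.cauchySeq).add
      (cauchySeq_iff_tendsto_dist_atTop_0.mp hK)).const_mul C
    rw [add_zero, mul_zero] at hlim
    refine cauchySeq_iff_tendsto_dist_atTop_0.mpr
      (squeeze_zero (fun _ => dist_nonneg) (fun p => ?_) hlim)
    simpa [dist_eq_norm] using hC (f p.1 - f p.2)
  obtain ⟨ψ, hψ⟩ := cauchySeq_tendsto_of_complete hcauchy
  obtain ⟨hd, h⟩ := exists_opSub_eq_of_tendsto hT hψ hη
  exact ⟨⟨ψ, hd⟩, hψ, h⟩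

theorem exists_norm_le_mul_of_isCompactOperator (hT : T.IsClosed) (hK : IsCompactOperator K)
    (hC : ∀ ψ : T.domain, ‖(ψ : H)‖ ≤ C * (‖opSub T x ψ‖ + ‖K ψ‖)) (hx : x ∉ pointSpectrum T) :
    ∃ C' : ℝ, ∀ ψ : T.domain, ‖(ψ : H)‖ ≤ C' * ‖opSub T x ψ‖ := by
  by_contra! hunbounded
  obtain ⟨f, hf1, hf0⟩ := exists_norm_eq_one_tendsto_zero (opSub T x) hunbounded
  obtain ⟨S, hS, hKS⟩ := hK.image_closedBall_subset_compact 1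
  obtain ⟨_, -, g, hg, hKg⟩ := hS.tendsto_subseq (x := fun k => K (f k)) fun k =>
    hKS ⟨f k, mem_closedBall_zero_iff.mpr (hf1 k).le, rfl⟩
  obtain ⟨ψ, hψ, hψ0⟩ := exists_tendsto_of_norm_le_mul_add hT hC (f := f ∘ g)
    (hf0.comp hg.tendsto_atTop) hKg.cauchySeq
  have hψ1 : ‖(ψ : H)‖ = 1 :=
    tendsto_nhds_unique hψ.norm (tendsto_const_nhds.congr fun k => (hf1 (g k)).symm)
  have hmem := mem_opEigenspace_of_opSub_eq_zero hψ0
  rw [not_not.mp hx, Submodule.mem_bot] at hmem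
  simp [hmem] at hψ1

theorem isClosed_range_opSub (hT : T.IsClosed)
    (hC : ∀ ψ : T.domain, ‖(ψ : H)‖ ≤ C * ‖opSub T x ψ‖) :
    IsClosed (LinearMap.range (opSub T x) : Set H) := by
  refine IsSeqClosed.isClosed fun u η hu hη => ?_
  choose f hf using hu
  obtain rfl : (fun k => opSub T x (f k)) = u := funext hf
  obtain ⟨ψ, -, h⟩ := exists_tendsto_of_norm_le_mul_add (K := (0 : H →L[ℂ] H)) hT
    (by simpa using hC) hη (by simpa using cauchySeq_const (0 : H))
  exact ⟨ψ, h⟩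

theorem inResolventSet_of_norm_le_mul (hT : T.IsClosed)
    (hC : ∀ ψ : T.domain, ‖(ψ : H)‖ ≤ C * ‖opSub T x ψ‖)
    (hdense : (LinearMap.range (opSub T x))ᗮ = ⊥) : InResolventSet T x := by
  have hinj : Function.Injective (opSub T x) :=
    (injective_iff_map_eq_zero _).mpr fun ψ hψ => Subtype.ext <| by simpa [hψ] using hC ψ
  have hsurj : Function.Surjective (opSub T x) := by
    rw [← LinearMap.range_eq_top, ← (isClosed_range_opSub hT hC).submodule_topologicalClosure_eq,
      Submodule.topologicalClosure_eq_top_iff, hdense]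
  let e := LinearEquiv.ofBijective (opSub T x) ⟨hinj, hsurj⟩
  have he (φ : H) : opSub T x (e.symm φ) = φ := e.apply_symm_apply φ
  let R : H →L[ℂ] H := (T.domain.subtype ∘ₗ e.symm.toLinearMap).mkContinuous C fun φ => by
    simpa [he] using hC (e.symm φ)
  exact ⟨R, fun φ => ⟨(e.symm φ).2, he φ⟩,
    fun ψ => congrArg Subtype.val (e.symm_apply_apply ψ)⟩

end Closed

end UnboundedOperators

/-! ### Operators on `ℓ²(ℤ)` -/

namespace EllTwo

theorem norm_apply_le (ψ : EllTwo) (n : ℤ) : ‖ψ n‖ ≤ ‖ψ‖ :=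
  lp.norm_apply_le_norm two_ne_zero ψ n

theorem norm_le_mul_of_forall {φ ψ : EllTwo} {C : ℝ} (hC : 0 ≤ C)
    (h : ∀ n, ‖φ n‖ ≤ C * ‖ψ n‖) : ‖φ‖ ≤ C * ‖ψ‖ := by
  have hle : ‖φ‖ ≤ ‖(C : ℂ) • ψ‖ := lp.norm_mono two_ne_zero fun n => by
    rw [lp.coeFn_smul, Pi.smul_apply, norm_smul, Complex.norm_real, Real.norm_of_nonneg hC]
    exact h n
  rwa [norm_smul, Complex.norm_real, Real.norm_of_nonneg hC] at hle

theorem tendsto_apply {ι : Type*} {l : Filter ι} {f : ι → EllTwo} {ψ : EllTwo}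
    (h : Tendsto f l (𝓝 ψ)) (n : ℤ) : Tendsto (fun i => f i n) l (𝓝 (ψ n)) :=
  ((lp.evalCLM ℂ (fun _ : ℤ => ℂ) 2 n).continuous.tendsto ψ).comp h

theorem tendsto_atBot (ψ : EllTwo) : Tendsto (fun n => ψ n) atBot (𝓝 0) := by
  have h := ((lp.memℓp ψ).summable (by norm_num)).tendsto_cofinite_zero
  simp only [ENNReal.toReal_ofNat, Real.rpow_ofNat] at h
  rw [Int.cofinite_eq] at h
  rw [tendsto_zero_iff_norm_tendsto_zero]
  simpa using (h.mono_left le_sup_left).sqrt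

/-- The shift `(ψₙ)ₙ ↦ (ψₙ₊ₖ)ₙ`. -/
noncomputable def shift (k : ℤ) : EllTwo →ₗᵢ[ℂ] EllTwo where
  toFun ψ := ⟨fun n => ψ (n + k), memlp_shift ψ k⟩
  map_add' _ _ := rfl
  map_smul' _ _ := rfl
  norm_map' ψ := by
    simp only [lp.norm_eq_tsum_rpow (p := 2) (by norm_num)]
    exact congrArg (· ^ _) ((Equiv.addRight k).tsum_eq fun n => ‖ψ n‖ ^ (2 : ENNReal).toReal)

/-- The orthogonal projection of `ℓ²(ℤ)` onto the sequences supported in `S`. -/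
noncomputable def restrict (S : Set ℤ) : EllTwo →L[ℂ] EllTwo :=
  LinearMap.mkContinuous
    { toFun ψ := ⟨S.indicator ψ,
        (lp.memℓp ψ).norm.mono fun n => by simpa using norm_indicator_le_norm_self ψ n⟩
      map_add' φ ψ := lp.ext (Set.indicator_add S φ ψ)
      map_smul' c ψ := lp.ext (Set.indicator_const_smul S c ψ) } 1
    fun ψ => norm_le_mul_of_forall zero_le_one fun n => by
      simpa using norm_indicator_le_norm_self ψ n

theorem restrict_apply (S : Set ℤ) (ψ : EllTwo) (n : ℤ) : restrict S ψ n = S.indicator ψ n := rfl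

theorem norm_restrict_mono {S S' : Set ℤ} (h : S ⊆ S') (ψ : EllTwo) :
    ‖restrict S ψ‖ ≤ ‖restrict S' ψ‖ :=
  lp.norm_mono two_ne_zero fun n => norm_indicator_le_of_subset h ψ n

theorem norm_restrict_le (S : Set ℤ) (ψ : EllTwo) : ‖restrict S ψ‖ ≤ ‖ψ‖ :=
  lp.norm_mono two_ne_zero fun n => norm_indicator_le_norm_self ψ n

theorem norm_apply_le_norm_restrict {S : Set ℤ} {n : ℤ} (hn : n ∈ S) (ψ : EllTwo) :
    ‖ψ n‖ ≤ ‖restrict S ψ‖ := by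
  simpa [restrict_apply, hn] using norm_apply_le (restrict S ψ) n

theorem norm_restrict_le_mul_of_forall {S : Set ℤ} {φ ψ : EllTwo} {C : ℝ} (hC : 0 ≤ C)
    (h : ∀ n ∈ S, ‖φ n‖ ≤ C * ‖ψ n‖) : ‖restrict S φ‖ ≤ C * ‖ψ‖ :=
  norm_le_mul_of_forall hC fun n => by
    by_cases hn : n ∈ S
    · simpa [restrict_apply, hn] using h n hn
    · simpa [restrict_apply, hn] using mul_nonneg hC (norm_nonneg _)

theorem isCompactOperator_restrict {S : Set ℤ} (hS : S.Finite) :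
    IsCompactOperator (restrict S) := by
  have hsum : restrict S = ∑ n ∈ hS.toFinset,
      lp.singleContinuousLinearMap ℂ (fun _ : ℤ => ℂ) 2 n ∘L lp.evalCLM ℂ (fun _ => ℂ) 2 n := by
    ext ψ n
    rw [sum_apply, lp.coeFn_sum, Finset.sum_apply]
    change S.indicator ψ n = ∑ i ∈ hS.toFinset, Pi.single (M := fun _ => ℂ) i (ψ i) n
    by_cases hn : n ∈ S <;> simp [hn]
  rw [hsum]
  exact Submodule.sum_mem (compactOperator (RingHom.id ℂ) EllTwo EllTwo) fun n _ =>
    (isCompactOperator_of_locallyCompactSpace_rng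
      (lp.singleContinuousLinearMap ℂ (fun _ : ℤ => ℂ) 2 n)).comp_clm _

/-- The free Jacobi operator `ψ ↦ (ψₙ₋₁ + ψₙ₊₁)ₙ`. -/
noncomputable def freeJacobi : EllTwo →L[ℂ] EllTwo :=
  (shift (-1)).toContinuousLinearMap + (shift 1).toContinuousLinearMap

theorem freeJacobi_apply (ψ : EllTwo) (n : ℤ) : freeJacobi ψ n = ψ (n - 1) + ψ (n + 1) := rfl

theorem norm_freeJacobi_le (ψ : EllTwo) : ‖freeJacobi ψ‖ ≤ 2 * ‖ψ‖ := by
  refine (norm_add_le (shift (-1) ψ) (shift 1 ψ)).trans_eq ?_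
  rw [LinearIsometry.norm_map, LinearIsometry.norm_map, two_mul]

theorem freeJacobi_restrict_Iic (a : ℤ) (ψ : EllTwo) :
    freeJacobi (restrict (Set.Iic a) ψ) = restrict (Set.Iic a) (freeJacobi ψ)
      + (lp.single 2 (a + 1) (ψ a) - lp.single 2 a (ψ (a + 1))) := by
  ext n
  simp only [freeJacobi_apply, restrict_apply, lp.coeFn_add, lp.coeFn_sub, Pi.add_apply,
    Pi.sub_apply, lp.single_apply, Pi.single_apply, Set.indicator_apply, Set.mem_Iic]
  grind

theorem norm_le_norm_sub_smul_shift (w : ℂ) (k : ℤ) (φ : EllTwo) :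
    (1 - ‖w‖) * ‖φ‖ ≤ ‖φ - w • shift k φ‖ := by
  have h := norm_sub_norm_le φ (w • shift k φ)
  rw [norm_smul, LinearIsometry.norm_map] at h
  linarith

theorem smul_freeJacobi_sub {w : ℂ} (hw : w ≠ 0) (φ : EllTwo) :
    w • (freeJacobi φ - (w + w⁻¹) • φ)
      = -((φ - w • shift 1 φ) - w • shift (-1) (φ - w • shift 1 φ)) := by
  ext n
  change w * (φ (n + -1) + φ (n + 1) - (w + w⁻¹) * φ n)
    = -((φ n - w * φ (n + 1)) - w * (φ (n + -1) - w * φ (n + -1 + 1)))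
  rw [neg_add_cancel_right]
  field_simp
  ring

theorem mul_norm_le_norm_freeJacobi_sub {w : ℂ} (hw0 : w ≠ 0) (hw1 : ‖w‖ ≤ 1) (φ : EllTwo) :
    (1 - ‖w‖) ^ 2 / ‖w‖ * ‖φ‖ ≤ ‖freeJacobi φ - (w + w⁻¹) • φ‖ := by
  have hnorm := congrArg norm (smul_freeJacobi_sub hw0 φ)
  rw [norm_smul, norm_neg] at hnorm
  rw [div_mul_eq_mul_div, div_le_iff₀ (norm_pos_iff.mpr hw0), mul_comm ‖_ - _‖, hnorm, sq,
    mul_assoc]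
  exact (mul_le_mul_of_nonneg_left (norm_le_norm_sub_smul_shift w 1 φ) (sub_nonneg.mpr hw1)).trans
    (norm_le_norm_sub_smul_shift w (-1) _)

end EllTwo

/-! ### A priori estimates -/

section APriori

open EllTwo

variable {V : ℤ → ℂ} {x : ℂ} {ψ η : EllTwo} {c : ℝ}

theorem norm_restrict_Iic_le_of_mul_norm_le (hc : 0 < c)
    (hJ : ∀ φ : EllTwo, c * ‖φ‖ ≤ ‖freeJacobi φ - x • φ‖) {a : ℤ} (hV : ∀ n ≤ a, ‖V n‖ ≤ c / 2)
    (h : ∀ n, ψ (n - 1) + V n * ψ n + ψ (n + 1) = x * ψ n + η n) :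
    ‖restrict (Set.Iic a) ψ‖ ≤ 2 / c * (‖η‖ + ‖ψ a‖ + ‖ψ (a + 1)‖) := by
  set P := restrict (Set.Iic a) with hP
  let β : EllTwo := lp.single 2 (a + 1) (ψ a) - lp.single 2 a (ψ (a + 1))
  let ρ : EllTwo := freeJacobi ψ - x • ψ - η
  have hresidual : freeJacobi (P ψ) - x • P ψ = P η + P ρ + β := by
    rw [hP, freeJacobi_restrict_Iic, ← map_add, add_sub_cancel, map_sub, map_smul]
    exact add_sub_right_comm _ _ _
  have hβ : ‖β‖ ≤ ‖ψ a‖ + ‖ψ (a + 1)‖ := by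
    simpa only [lp.norm_single two_pos] using
      norm_sub_le (lp.single 2 (a + 1) (ψ a) : EllTwo) (lp.single 2 a (ψ (a + 1)))
  have hρ : ‖P ρ‖ ≤ c / 2 * ‖P ψ‖ := by
    refine norm_le_mul_of_forall (by positivity) fun n => ?_
    by_cases hn : n ≤ a
    · have hρn : ρ n = -(V n * ψ n) := by
        change freeJacobi ψ n - x * ψ n - η n = _
        rw [freeJacobi_apply]
        linear_combination h n
      simpa [hP, restrict_apply, hn, hρn] using
        mul_le_mul_of_nonneg_right (hV n hn) (norm_nonneg (ψ n))
    · simp [hP, restrict_apply, hn]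
  have hlower := hJ (P ψ)
  rw [hresidual] at hlower
  have hupper := (norm_add₃_le (a := P η) (b := P ρ) (c := β)).trans
    (add_le_add_three (norm_restrict_le _ η) hρ hβ)
  rw [div_mul_eq_mul_div, le_div_iff₀ hc]
  linarith

theorem norm_restrict_le_of_four_le {S : Set ℤ} (hV : ∀ n ∈ S, 4 ≤ ‖V n - x‖)
    (h : ∀ n, ψ (n - 1) + V n * ψ n + ψ (n + 1) = x * ψ n + η n) :
    ‖restrict S ψ‖ ≤ 1 / 4 * (‖η‖ + 2 * ‖ψ‖) := by
  have hle : ‖restrict S ψ‖ ≤ 1 / 4 * ‖η - freeJacobi ψ‖ := by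
    refine norm_restrict_le_mul_of_forall (by norm_num) fun n hn => ?_
    have heq : (η - freeJacobi ψ) n = (V n - x) * ψ n := by
      change η n - freeJacobi ψ n = _
      rw [freeJacobi_apply]
      linear_combination -h n
    rw [heq, norm_mul]
    linarith [mul_le_mul_of_nonneg_right (hV n hn) (norm_nonneg (ψ n))]
  linarith [norm_sub_le η (freeJacobi ψ), norm_freeJacobi_le ψ]

theorem norm_le_add_norm_restrict (a b : ℤ) (ψ : EllTwo) :
    ‖ψ‖ ≤ ‖restrict (Set.Iic a) ψ‖ + ‖restrict (Set.Icc a b) ψ‖ + ‖restrict (Set.Ioi b) ψ‖ := by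
  have hsplit : ψ = restrict (Set.Iic a) ψ + restrict (Set.Ioc a b) ψ
      + restrict (Set.Ioi b \ Set.Iic a) ψ := by
    ext n
    simp only [lp.coeFn_add, Pi.add_apply, restrict_apply, Set.indicator_apply, Set.mem_Iic,
      Set.mem_Ioc, Set.mem_Ioi, Set.mem_sdiff]
    grind
  calc ‖ψ‖ ≤ ‖restrict (Set.Iic a) ψ‖ + ‖restrict (Set.Ioc a b) ψ‖
        + ‖restrict (Set.Ioi b \ Set.Iic a) ψ‖ := by
        conv_lhs => rw [hsplit]
        exact norm_add₃_le
    _ ≤ _ := by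
        gcongr
        · exact norm_restrict_mono Set.Ioc_subset_Icc_self ψ
        · exact norm_restrict_mono Set.sdiff_subset ψ

theorem exists_norm_le_mul_norm_add_norm_restrict (hbot : Tendsto V atBot (𝓝 0))
    (htop : Tendsto (fun n => ‖V n‖) atTop atTop) (hc : 0 < c)
    (hJ : ∀ φ : EllTwo, c * ‖φ‖ ≤ ‖freeJacobi φ - x • φ‖) :
    ∃ (C : ℝ) (S : Set ℤ), S.Finite ∧ ∀ ψ η : EllTwo,
      (∀ n, ψ (n - 1) + V n * ψ n + ψ (n + 1) = x * ψ n + η n) →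
      ‖ψ‖ ≤ C * (‖η‖ + ‖restrict S ψ‖) := by
  obtain ⟨a, ha⟩ := eventually_atBot.mp
    (hbot.norm.eventually (ge_mem_nhds (norm_zero.trans_lt (half_pos hc))))
  obtain ⟨b, hab, hb⟩ : ∃ b > a, ∀ n > b, 4 ≤ ‖V n - x‖ := by
    obtain ⟨b, hb⟩ := eventually_atTop.mp (htop.eventually_ge_atTop (4 + ‖x‖))
    refine ⟨max b (a + 1), by omega, fun n hn => ?_⟩
    linarith [hb n (by omega), norm_sub_norm_le (V n) x]
  refine ⟨8 / c + 2, Set.Icc a b, Set.finite_Icc a b, fun ψ η h => ?_⟩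
  set R := ‖restrict (Set.Icc a b) ψ‖
  have hψa : ‖ψ a‖ ≤ R := norm_apply_le_norm_restrict (Set.left_mem_Icc.mpr hab.le) ψ
  have hψa1 : ‖ψ (a + 1)‖ ≤ R := norm_apply_le_norm_restrict (Set.mem_Icc.mpr ⟨by omega, hab⟩) ψ
  have hleft : ‖restrict (Set.Iic a) ψ‖ ≤ 2 / c * (2 * (‖η‖ + R)) :=
    (norm_restrict_Iic_le_of_mul_norm_le hc hJ ha h).trans <|
      mul_le_mul_of_nonneg_left (by linarith [norm_nonneg η]) (by positivity)
  have hright := norm_restrict_le_of_four_le (S := Set.Ioi b) hb h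
  have hsplit := norm_le_add_norm_restrict a b ψ
  calc ‖ψ‖ ≤ 2 * (2 / c * (2 * (‖η‖ + R))) + 2 * (‖η‖ + R) := by
        linarith [norm_nonneg η, norm_nonneg (restrict (Set.Icc a b) ψ)]
    _ = (8 / c + 2) * (‖η‖ + R) := by ring

end APriori

/-! ### Maximal Schrödinger operators -/

/-- `T` is the maximal operator `(Tψ)ₙ = ψₙ₋₁ + V n ψₙ + ψₙ₊₁` in `ℓ²(ℤ)`: its domain consists of
all `ψ` for which the right-hand side is square-summable. -/
def IsMaximalSchrodinger (T : EllTwo →ₗ.[ℂ] EllTwo) (V : ℤ → ℂ) : Prop :=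
  ∀ ψ η : EllTwo, (ψ, η) ∈ T.graph ↔ ∀ n, ψ (n - 1) + V n * ψ n + ψ (n + 1) = η n

namespace IsMaximalSchrodinger

variable {T : EllTwo →ₗ.[ℂ] EllTwo} {V : ℤ → ℂ} {x : ℂ}

theorem recurrence_opSub (hT : IsMaximalSchrodinger T V) (ψ : T.domain) (n : ℤ) :
    (ψ : EllTwo) (n - 1) + V n * (ψ : EllTwo) n + (ψ : EllTwo) (n + 1)
      = x * (ψ : EllTwo) n + opSub T x ψ n := by
  rw [(hT ψ (T ψ)).mp (T.mem_graph ψ) n]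
  exact (add_sub_cancel (x * (ψ : EllTwo) n) (T ψ n)).symm

theorem isClosed (hT : IsMaximalSchrodinger T V) : T.IsClosed := by
  refine IsSeqClosed.isClosed fun u p hu hp => (hT p.1 p.2).mpr fun n => ?_
  have hψ (n : ℤ) := EllTwo.tendsto_apply hp.fst_nhds n
  exact tendsto_nhds_unique
    ((((hψ (n - 1)).add ((hψ n).const_mul (V n))).add (hψ (n + 1))).congr fun k =>
      (hT _ _).mp (hu k) n)
    (EllTwo.tendsto_apply hp.snd_nhds n)

theorem mem_opEigenspace_iff (hT : IsMaximalSchrodinger T V) (ψ : EllTwo) :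
    ψ ∈ opEigenspace T x ↔ IsSchrodingerSol V x ψ := by
  refine Iff.trans ?_ (hT ψ (x • ψ))
  rw [_root_.mem_opEigenspace_iff, LinearPMap.mem_graph_iff]
  exact ⟨fun ⟨h, hx⟩ => ⟨⟨ψ, h⟩, rfl, hx⟩, fun ⟨⟨_, h⟩, rfl, hx⟩ => ⟨h, hx⟩⟩

theorem mem_pointSpectrum_iff (hT : IsMaximalSchrodinger T V) :
    x ∈ pointSpectrum T ↔ ∃ ψ : EllTwo, IsSchrodingerSol V x ψ ∧ ψ ≠ 0 := by
  simp only [pointSpectrum, Set.mem_ofPred_eq, Submodule.ne_bot_iff, hT.mem_opEigenspace_iff]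

theorem isSimpleEigenvalue (hT : IsMaximalSchrodinger T V) (hx : x ∈ pointSpectrum T) :
    IsSimpleEigenvalue T x := by
  obtain ⟨φ, hφ, hφ0⟩ := hT.mem_pointSpectrum_iff.mp hx
  obtain ⟨k, hk⟩ : ∃ k, φ k ≠ 0 := by
    by_contra! h
    exact hφ0 (lp.ext (funext h))
  refine (finrank_eq_one_iff_of_nonzero'
    (⟨φ, (hT.mem_opEigenspace_iff φ).mpr hφ⟩ : opEigenspace T x)
    (fun h => hφ0 (congrArg Subtype.val h))).mpr fun ⟨ψ, hmem⟩ => ?_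
  have hψ := (hT.mem_opEigenspace_iff ψ).mp hmem
  obtain ⟨c, hc⟩ := hφ.exists_eq_mul hψ
    (hφ.casoratian_eq_zero_of_tendsto hψ φ.tendsto_atBot ψ.tendsto_atBot) hk
  exact ⟨c, Subtype.ext (lp.ext (funext fun n => (hc n).symm))⟩

/-- For complex `V` the adjoint of `T` has potential `star V`, but the entrywise conjugate of an
element of `Ker (T* - star x)` again solves the equation with potential `V` and parameter `x`. -/
theorem isSchrodingerSol_star_of_mem_orthogonal (hT : IsMaximalSchrodinger T V) {φ : EllTwo}
    (hφ : φ ∈ (LinearMap.range (opSub T x))ᗮ) : IsSchrodingerSol V x (star φ : EllTwo) := by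
  intro n
  obtain ⟨δ, hδ, hTδ⟩ := T.mem_graph_iff.mp <| (hT (lp.single 2 n 1)
    (lp.single 2 (n + 1) 1 + lp.single 2 n (V n) + lp.single 2 (n - 1) 1)).mpr fun j => by
      simp only [lp.coeFn_add, Pi.add_apply, lp.single_apply, Pi.single_apply]
      grind
  have horth := (Submodule.mem_orthogonal _ _).mp hφ _ ⟨δ, rfl⟩
  simp only at hδ hTδ
  rw [opSub_apply, hTδ, hδ, inner_sub_left, inner_smul_left, inner_add_left,
    inner_add_left] at horth
  simp only [lp.inner_single_left, RCLike.inner_apply, map_one, mul_one] at horth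
  have hstar := congrArg (starRingEnd ℂ) horth
  simp only [map_add, map_sub, map_mul, Complex.conj_conj, map_zero] at hstar
  simp only [lp.star_apply, RCLike.star_def]
  linear_combination hstar

theorem orthogonal_range_opSub (hT : IsMaximalSchrodinger T V) (hx : x ∉ pointSpectrum T) :
    (LinearMap.range (opSub T x))ᗮ = ⊥ := by
  refine (Submodule.eq_bot_iff _).mpr fun φ hφ => ?_
  by_contra hne
  exact hx (hT.mem_pointSpectrum_iff.mpr
    ⟨star φ, hT.isSchrodingerSol_star_of_mem_orthogonal hφ, star_ne_zero.mpr hne⟩)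

theorem inResolventSet (hT : IsMaximalSchrodinger T V) (hbot : Tendsto V atBot (𝓝 0))
    (htop : Tendsto (fun n => ‖V n‖) atTop atTop) {w : ℂ} (hw0 : w ≠ 0) (hw1 : ‖w‖ < 1)
    (hx : w + w⁻¹ ∉ pointSpectrum T) : InResolventSet T (w + w⁻¹) := by
  have hc : 0 < (1 - ‖w‖) ^ 2 / ‖w‖ :=
    div_pos (pow_pos (sub_pos.mpr hw1) 2) (norm_pos_iff.mpr hw0)
  obtain ⟨C, S, hS, hC⟩ := exists_norm_le_mul_norm_add_norm_restrict hbot htop hc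
    (EllTwo.mul_norm_le_norm_freeJacobi_sub hw0 hw1.le)
  obtain ⟨C', hC'⟩ := exists_norm_le_mul_of_isCompactOperator hT.isClosed
    (EllTwo.isCompactOperator_restrict hS)
    (fun ψ : T.domain => hC ψ (opSub T (w + w⁻¹) ψ) (hT.recurrence_opSub ψ)) hx
  exact inResolventSet_of_norm_le_mul hT.isClosed hC' (hT.orthogonal_range_opSub hx)

end IsMaximalSchrodinger

/-! ### The spectrum -/

theorem exists_eq_add_inv (x : ℂ) : ∃ w : ℂ, w ≠ 0 ∧ ‖w‖ ≤ 1 ∧ x = w + w⁻¹ := by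
  obtain ⟨s, hs⟩ := IsAlgClosed.exists_pow_nat_eq (x ^ 2 - 4) two_pos
  have hprod : (x + s) / 2 * ((x - s) / 2) = 1 := by linear_combination -hs / 4
  have hminus : (x - s) / 2 = ((x + s) / 2)⁻¹ := eq_inv_of_mul_eq_one_right hprod
  have hplus : (x + s) / 2 = ((x - s) / 2)⁻¹ := eq_inv_of_mul_eq_one_left hprod
  rcases le_total ‖(x + s) / 2‖ 1 with h | h
  · exact ⟨_, left_ne_zero_of_mul_eq_one hprod, h, by rw [← hminus]; ring⟩
  · refine ⟨_, right_ne_zero_of_mul_eq_one hprod, ?_, by rw [← hplus]; ring⟩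
    rw [hminus, norm_inv]
    exact inv_le_one_of_one_le₀ h

theorem add_inv_mem_Icc_of_norm_eq_one {w : ℂ} (hw : ‖w‖ = 1) :
    w + w⁻¹ ∈ ((↑) : ℝ → ℂ) '' Set.Icc (-2) 2 := by
  have h := (Complex.abs_re_le_norm w).trans_eq hw
  rw [abs_le] at h
  refine ⟨2 * w.re, ⟨by linarith, by linarith⟩, ?_⟩
  rw [Complex.inv_eq_conj hw, Complex.add_conj]

theorem ofReal_add_inv_notMem_Icc {r : ℝ} (hr0 : r ≠ 0) (hr1 : |r| < 1) :
    (r : ℂ) + (r : ℂ)⁻¹ ∉ ((↑) : ℝ → ℂ) '' Set.Icc (-2) 2 := by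
  rintro ⟨t, ht, h⟩
  have hquad : t * r = |r| ^ 2 + 1 := by
    have ht : t = r + r⁻¹ := by exact_mod_cast h
    rw [ht, sq_abs]
    field_simp
  have hle : t * r ≤ 2 * |r| := by
    refine (le_abs_self _).trans ?_
    rw [abs_mul]
    exact mul_le_mul_of_nonneg_right (abs_le.mpr ht) (abs_nonneg r)
  have hpos : 0 < (1 - |r|) ^ 2 := pow_pos (by linarith) 2
  linarith [sub_sq 1 |r|]

theorem IsMaximalSchrodinger.opSpectrum_diff_Icc_subset {T : EllTwo →ₗ.[ℂ] EllTwo} {V : ℤ → ℂ}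
    (hT : IsMaximalSchrodinger T V) (hbot : Tendsto V atBot (𝓝 0))
    (htop : Tendsto (fun n => ‖V n‖) atTop atTop) :
    opSpectrum T \ (((↑) : ℝ → ℂ) '' Set.Icc (-2) 2) ⊆ pointSpectrum T := by
  rintro x ⟨hx, hIcc⟩
  obtain ⟨w, hw0, hw1, rfl⟩ := exists_eq_add_inv x
  have hw : ‖w‖ < 1 := lt_of_le_of_ne hw1 fun h => hIcc (add_inv_mem_Icc_of_norm_eq_one h)
  by_contra hp
  exact hx (hT.inResolventSet hbot htop hw0 hw hp)

section OpB

variable {α q : ℝ}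

theorem isMaximalSchrodinger_opB (hα : α ≠ 0) :
    IsMaximalSchrodinger (opB α q) (geomPotential α q) := by
  intro ψ η
  rw [LinearPMap.mem_graph_iff]
  constructor
  · rintro ⟨⟨φ, hφ⟩, rfl, rfl⟩ n
    rfl
  · intro h
    have hdom : Memℓp (fun n : ℤ => (q : ℂ) ^ (-n) * ψ n) 2 := by
      convert lp.memℓp ((α : ℂ)⁻¹ • (η - EllTwo.freeJacobi ψ)) using 1
      funext n
      change _ = (α : ℂ)⁻¹ * (η n - EllTwo.freeJacobi ψ n)
      rw [EllTwo.freeJacobi_apply, ← h n, geomPotential]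
      have := Complex.ofReal_ne_zero.mpr hα
      field_simp
      ring
    exact ⟨⟨ψ, hdom⟩, rfl, lp.ext (funext h)⟩

theorem floor_logb_lt_iff (hq0 : 0 < q) (hq1 : q < 1) (hα : α ≠ 0) (m : ℤ) :
    ⌊Real.logb q |α|⌋ < m ↔ ‖(α : ℂ)⁻¹ * (q : ℂ) ^ m‖ < 1 := by
  have hα' : 0 < |α| := abs_pos.mpr hα
  rw [Int.floor_lt, Real.logb_lt_iff_lt_rpow_of_base_lt_one hq0 hq1 hα', Real.rpow_intCast,
    norm_mul, norm_inv, norm_zpow, Complex.norm_real, Complex.norm_real,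
    Real.norm_of_nonneg hq0.le, Real.norm_eq_abs, inv_mul_lt_iff₀ hα', mul_one]

theorem eigvalB_notMem_Icc (hq : q ≠ 0) (hα : α ≠ 0) {m : ℤ}
    (hw : ‖(α : ℂ)⁻¹ * (q : ℂ) ^ m‖ < 1) :
    eigvalB α q m ∉ ((↑) : ℝ → ℂ) '' Set.Icc (-2) 2 := by
  have hcast : (α : ℂ)⁻¹ * (q : ℂ) ^ m = ((α⁻¹ * q ^ m : ℝ) : ℂ) := by push_cast; rfl
  rw [hcast, Complex.norm_real, Real.norm_eq_abs] at hw
  rw [eigvalB_eq_add_inv, hcast]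
  exact ofReal_add_inv_notMem_Icc (mul_ne_zero (inv_ne_zero hα) (zpow_ne_zero m hq)) hw

theorem exists_eigenvector_opB (hq0 : q ≠ 0) (hq1 : ‖(q : ℂ)‖ < 1) (hα : α ≠ 0) {m : ℤ}
    (hw : ‖(α : ℂ)⁻¹ * (q : ℂ) ^ m‖ < 1) :
    ∃ v : EllTwo, (∀ j : ℤ, v j = eigvecB α q m j) ∧ v ≠ 0 ∧
      v ∈ opEigenspace (opB α q) (eigvalB α q m) := by
  have hmem : Memℓp (eigvecB α q m) 1 :=
    memℓp_gen (by simpa using (summable_eigvecB hq0 hq1 hα hw).norm)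
  refine ⟨⟨eigvecB α q m, hmem.of_exponent_ge one_le_two⟩, fun _ => rfl, fun h => ?_,
    ((isMaximalSchrodinger_opB hα).mem_opEigenspace_iff _).mpr
      (isSchrodingerSol_eigvecB hq0 hq1 hα hw)⟩
  obtain ⟨j, hj⟩ := exists_eigvecB_ne_zero hq0 hq1 hα hw
  exact hj (congrArg (fun φ : EllTwo => φ j) h)

theorem exists_eq_eigvalB_of_mem_pointSpectrum (hq0 : 0 < q) (hq1 : q < 1) (hα : α ≠ 0) {x : ℂ}
    (hx : x ∈ pointSpectrum (opB α q)) :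
    ∃ m : ℤ, ‖(α : ℂ)⁻¹ * (q : ℂ) ^ m‖ < 1 ∧ x = eigvalB α q m := by
  obtain ⟨ψ, hψ, hψ0⟩ := (isMaximalSchrodinger_opB hα).mem_pointSpectrum_iff.mp hx
  obtain ⟨w, hw0, hw1, rfl⟩ := exists_eq_add_inv x
  have hne : ∃ n, ψ n ≠ 0 := by
    by_contra! h
    exact hψ0 (lp.ext (funext h))
  have hqc : (q : ℂ) ≠ 0 := Complex.ofReal_ne_zero.mpr hq0.ne'
  have hqn : ‖(q : ℂ)‖ < 1 := by rwa [Complex.norm_real, Real.norm_of_nonneg hq0.le]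
  have hαc : (α : ℂ) ≠ 0 := Complex.ofReal_ne_zero.mpr hα
  obtain ⟨m, hm⟩ := hψ.exists_mul_eq_zpow hqc hqn hαc hw0 hw1 ψ.norm_apply_le ψ.tendsto_atBot hne
  have hw : ‖w‖ < 1 :=
    hψ.norm_lt_one_of_mul_eq_zpow hq0 hq1 hw0 hw1 ψ.norm_apply_le ψ.tendsto_atBot hne hm
  obtain rfl : w = (α : ℂ)⁻¹ * (q : ℂ) ^ m := by rw [← hm, inv_mul_cancel_left₀ hαc]
  exact ⟨m, hw, (eigvalB_eq_add_inv α q m).symm⟩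

theorem pointSpectrum_opB (hq0 : 0 < q) (hq1 : q < 1) (hα : α ≠ 0) :
    pointSpectrum (opB α q) = {x : ℂ | ∃ m : ℤ, ⌊Real.logb q |α|⌋ < m ∧ x = eigvalB α q m} := by
  simp only [floor_logb_lt_iff hq0 hq1 hα]
  refine Set.Subset.antisymm
    (fun x hx => exists_eq_eigvalB_of_mem_pointSpectrum hq0 hq1 hα hx) ?_
  rintro _ ⟨m, hw, rfl⟩
  have hqn : ‖(q : ℂ)‖ < 1 := by rwa [Complex.norm_real, Real.norm_of_nonneg hq0.le]
  obtain ⟨v, -, hv0, hv⟩ := exists_eigenvector_opB hq0.ne' hqn hα hw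
  exact (Submodule.ne_bot_iff _).mpr ⟨v, hv, hv0⟩

theorem opSpectrum_opB_diff_Icc (hq0 : 0 < q) (hq1 : q < 1) (hα : α ≠ 0) :
    opSpectrum (opB α q) \ (((↑) : ℝ → ℂ) '' Set.Icc (-2) 2) = pointSpectrum (opB α q) := by
  have hqc : (q : ℂ) ≠ 0 := Complex.ofReal_ne_zero.mpr hq0.ne'
  have hqn : ‖(q : ℂ)‖ < 1 := by rwa [Complex.norm_real, Real.norm_of_nonneg hq0.le]
  refine Set.Subset.antisymm ((isMaximalSchrodinger_opB hα).opSpectrum_diff_Icc_subset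
    (tendsto_geomPotential_atBot hqc hqn α)
    (tendsto_norm_geomPotential_atTop hqc hqn (Complex.ofReal_ne_zero.mpr hα)))
    fun x hx => ⟨pointSpectrum_subset_opSpectrum _ hx, ?_⟩
  obtain ⟨m, hw, rfl⟩ := exists_eq_eigvalB_of_mem_pointSpectrum hq0 hq1 hα hx
  exact eigvalB_notMem_Icc hq0.ne' hα hw

end OpB

theorem mainTheorem4 (q α : ℝ) (hq0 : 0 < q) (hq1 : q < 1) (hα : α ≠ 0) :
    opSpectrum (opB α q) \ (((↑) : ℝ → ℂ) '' Set.Icc (-2) 2) = pointSpectrum (opB α q) ∧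
    pointSpectrum (opB α q) = {x : ℂ | ∃ m : ℤ, ⌊Real.logb q |α|⌋ < m ∧ x = eigvalB α q m} ∧
    (∀ x ∈ pointSpectrum (opB α q), IsSimpleEigenvalue (opB α q) x) ∧
    (∀ m : ℤ, ⌊Real.logb q |α|⌋ < m →
      ∃ v : EllTwo, (∀ j : ℤ, v j = eigvecB α q m j) ∧ v ≠ 0 ∧
        v ∈ opEigenspace (opB α q) (eigvalB α q m)) := by
  have hqn : ‖(q : ℂ)‖ < 1 := by rwa [Complex.norm_real, Real.norm_of_nonneg hq0.le]
  exact ⟨opSpectrum_opB_diff_Icc hq0 hq1 hα, pointSpectrum_opB hq0 hq1 hα,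
    fun _ hx => (isMaximalSchrodinger_opB hα).isSimpleEigenvalue hx,
    fun m hm => exists_eigenvector_opB hq0.ne' hqn hα ((floor_logb_lt_iff hq0 hq1 hα m).mp hm)⟩
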